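/- Let $\mathcal H=L^2(\mathbb R;\mathbb C)$, with position and momentum operators $\hat x,\hat p$, $[\hat x,\hat p]=i$, and let $D(\alpha,\beta)=\exp(i\sqrt2\,\beta\hat x-i\sqrt2\,\alpha\hat p)$ be the displacement operators, that is, $(D(\alpha,\beta)\psi)(x)=e^{i\sqrt2\beta x-i\alpha\beta}\,\psi(x-\sqrt2\,\alpha)$. Let $$\Delta(x,y;\theta)=\left[\frac{1+i\cot\theta}{2\pi}\right]^{1/2}\exp\left[-\frac{i(x^2+y^2)\cot\theta}{2}+\frac{ixy}{\sin\theta}\right]$$ be the kernel of the fractional Fourier transform (principal square root; $\Delta(x,y;\theta)=\delta(x-y)$ when $\cos\theta=1$ and $\Delta(x,y;\theta)=\delta(x+y)$ when $\cos\theta=-1$). Let $\theta_1,\theta_2\in\mathbb R$ with $\cos(\theta_1-\theta_2)\neq0$. For all $\alpha,\beta\in\mathbb R$ the formula $$U(\alpha,\beta;\theta_1,\theta_2)=|\cos(\theta_1-\theta_2)|^{1/2}\int d\alpha'\,d\beta'\,\Delta(\beta,\alpha';\theta_2)\,\Delta(\alpha,-\beta';\theta_1)\,D(\alpha',\beta')$$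 (an integral in the weak sense, between Schwartz functions) defines a bounded operator on $\mathcal H$, the bifractional displacement operator. For a trace class operator $\Theta$ on $\mathcal H$ put $$A(\alpha,\beta;\theta_1,\theta_2|\Theta)=\operatorname{Tr}\bigl(\Theta\,U(\alpha,\beta;\theta_1,\theta_2)\bigr),\qquad A^\dagger(\alpha,\beta;\theta_1,\theta_2|\Theta)=\operatorname{Tr}\bigl(\Theta\,U^\dagger(\alpha,\beta;\theta_1,\theta_2)\bigr),$$ so that $A^\dagger$ is the complex conjugate of $A$ when $\Theta$ is self-adjoint. Then the following hold. (1) Every trace class operator $\Theta$ on $\mathcal H$ can be reconstructed as $$\Theta=\frac1{\pi\,|\cos(\theta_1-\theta_2)|}\int_{\mathbb R^2}d\alpha\,d\beta\;A^\dagger(\alpha,\beta;\theta_1,\theta_2|\Theta)\,U(\alpha,\beta;\theta_1,\theta_2),$$ as a weak integral: for all $\varphi,\psi\in\mathcal H$ the function $A^\dagger(\alpha,\beta;\theta_1,\theta_2|\Theta)\,\langle\varphi,U(\alpha,\beta;\theta_1,\theta_2)\psi\rangle$ of $(\alpha,\beta)$ is integrable over $\mathbb R^2$, and $\frac1{\pi|\cos(\theta_1-\theta_2)|}$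 times its integral is $\langle\varphi,\Theta\psi\rangle$. (2) For all trace class operators $\Theta_1,\Theta_2$ on $\mathcal H$, $$\operatorname{Tr}(\Theta_1\Theta_2)=\frac1{\pi\,|\cos(\theta_1-\theta_2)|}\int_{\mathbb R^2}d\alpha\,d\beta\;A(\alpha,\beta;\theta_1,\theta_2|\Theta_1)\,A^\dagger(\alpha,\beta;\theta_1,\theta_2|\Theta_2),$$ where the integrand is integrable over $\mathbb R^2$. -/

import Mathlib

open MeasureTheory
open scoped InnerProductSpace SchwartzMap

namespace Bifractional

/-- The Hilbert space `L²(ℝ; ℂ)` of the harmonic oscillator (Schrödinger representation). -/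
abbrev H : Type := Lp ℂ 2 (volume : Measure ℝ)

/-! ### Displacement operators -/

/-- The function `x ↦ exp(i√2 β x - i α β) ψ(x - √2 α)`. -/
noncomputable def displaceFun (α β : ℝ) (ψ : ℝ → ℂ) (x : ℝ) : ℂ :=
  Complex.exp (Complex.I * ((√2 * β * x - α * β : ℝ) : ℂ)) * ψ (x - √2 * α)

lemma norm_displaceFun (α β : ℝ) (ψ : ℝ → ℂ) (x : ℝ) :
    ‖displaceFun α β ψ x‖ = ‖ψ (x - √2 * α)‖ := by
  rw [displaceFun, norm_mul, mul_comm Complex.I, Complex.norm_exp_ofReal_mul_I, one_mul]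

lemma aestronglyMeasurable_displaceFun (α β : ℝ) {ψ : ℝ → ℂ}
    (hψ : AEStronglyMeasurable ψ volume) :
    AEStronglyMeasurable (displaceFun α β ψ) volume := by
  refine AEStronglyMeasurable.mul ?_ ?_
  · exact (by fun_prop : Continuous fun x : ℝ =>
      Complex.exp (Complex.I * ((√2 * β * x - α * β : ℝ) : ℂ))).aestronglyMeasurable
  · exact hψ.comp_measurePreserving (measurePreserving_sub_right volume (√2 * α))

lemma eLpNorm_displaceFun (α β : ℝ) {ψ : ℝ → ℂ} (hψ : AEStronglyMeasurable ψ volume) :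
    eLpNorm (displaceFun α β ψ) 2 volume = eLpNorm ψ 2 volume := by
  rw [eLpNorm_congr_norm_ae (g := ψ ∘ fun x => x - √2 * α)
    (Filter.Eventually.of_forall fun x => norm_displaceFun α β ψ x)]
  exact eLpNorm_comp_measurePreserving hψ (measurePreserving_sub_right volume (√2 * α))

lemma memLp_displaceFun (α β : ℝ) {ψ : ℝ → ℂ} (hψ : MemLp ψ 2 volume) :
    MemLp (displaceFun α β ψ) 2 volume :=
  ⟨aestronglyMeasurable_displaceFun α β hψ.1, by
    rw [eLpNorm_displaceFun α β hψ.1]; exact hψ.2⟩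

lemma displaceFun_congr (α β : ℝ) {ψ φ : ℝ → ℂ} (h : ψ =ᵐ[volume] φ) :
    displaceFun α β ψ =ᵐ[volume] displaceFun α β φ := by
  have := (measurePreserving_sub_right (volume : Measure ℝ) (√2 * α)).quasiMeasurePreserving.ae_eq h
  filter_upwards [this] with x hx
  simp only [Function.comp_apply] at hx
  simp only [displaceFun, hx]

/-- The displacement operator `D(α, β) = exp(i√2 β x̂ - i√2 α p̂)` on `L²(ℝ)`, where
`(x̂ψ)(x) = x ψ(x)` and `p̂ψ = -i ψ'`. By the Weyl relations this exponential is
`(D(α, β)ψ)(x) = exp(i√2 β x - i α β) ψ(x - √2 α)`. -/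
noncomputable def D (α β : ℝ) : H →L[ℂ] H :=
  LinearIsometry.toContinuousLinearMap
    { toFun := fun ψ => (memLp_displaceFun α β (Lp.memLp ψ)).toLp
      map_add' := fun ψ φ => by
        rw [← MemLp.toLp_add, MemLp.toLp_eq_toLp_iff]
        refine (displaceFun_congr α β (Lp.coeFn_add ψ φ)).trans (Filter.Eventually.of_forall ?_)
        intro x
        simp only [displaceFun, Pi.add_apply, mul_add]
      map_smul' := fun c ψ => by
        rw [RingHom.id_apply, ← MemLp.toLp_const_smul, MemLp.toLp_eq_toLp_iff]
        refine (displaceFun_congr α β (Lp.coeFn_smul c ψ)).trans (Filter.Eventually.of_forall ?_)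
        intro x
        simp only [displaceFun, Pi.smul_apply, smul_eq_mul]
        ring
      norm_map' := fun ψ => by
        change ‖(memLp_displaceFun α β (Lp.memLp ψ)).toLp‖ = ‖ψ‖
        rw [Lp.norm_toLp, eLpNorm_displaceFun α β (Lp.memLp ψ).1, Lp.norm_def] }

lemma coeFn_D (α β : ℝ) (ψ : H) : D α β ψ =ᵐ[volume] displaceFun α β ψ :=
  (memLp_displaceFun α β (Lp.memLp ψ)).coeFn_toLp

/-! ### The fractional Fourier transform -/

/-- The kernel
`Δ(x, y; θ) = ((1 + i cot θ)/(2π))^{1/2} exp(-i (x² + y²) cot θ / 2 + i x y / sin θ)`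
of the fractional Fourier transform, for `sin θ ≠ 0` (principal square root). -/
noncomputable def Δ (x y θ : ℝ) : ℂ :=
  ((1 + Complex.I * (Real.cot θ : ℂ)) / (2 * (Real.pi : ℂ))) ^ (1 / 2 : ℂ) *
    Complex.exp (Complex.I *
      ((-((x ^ 2 + y ^ 2) * Real.cot θ / 2) + x * y / Real.sin θ : ℝ) : ℂ))

/-- `∫ dy Δ(x, y; θ) f(y)`. When `sin θ = 0`, i.e. `cos θ = ±1`, the kernel `Δ(x, y; θ)` is the
delta function `δ(x - y)` (for `cos θ = 1`) or `δ(x + y)` (for `cos θ = -1`). -/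
noncomputable def integralΔ (x θ : ℝ) (f : ℝ → ℂ) : ℂ :=
  open Classical in
  if Real.sin θ = 0 then f (Real.cos θ * x) else ∫ y : ℝ, Δ x y θ * f y

/-! ### Bifractional displacement operators -/

/-- `T` is the operator
`|cos(θ₁ - θ₂)|^{1/2} ∫ dα' dβ' Δ(β, α'; θ₂) Δ(α, -β'; θ₁) D(α', β')`,
the operator integral being the weak one: it is evaluated between Schwartz functions `φ`, `ψ`, for
which `(α', β') ↦ ⟪φ, D(α', β') ψ⟫` is a Schwartz function, so that the integrals converge
absolutely and their order does not matter. -/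
def IsBifractionalDisplacement (α β θ₁ θ₂ : ℝ) (T : H →L[ℂ] H) : Prop :=
  ∀ φ ψ : 𝓢(ℝ, ℂ),
    ⟪φ.toLp 2, T (ψ.toLp 2)⟫_ℂ =
      ((|Real.cos (θ₁ - θ₂)| ^ (1 / 2 : ℝ) : ℝ) : ℂ) *
        integralΔ β θ₂ fun α' =>
          -- the variable of integration is `y = -β'`
          integralΔ α θ₁ fun y => ⟪φ.toLp 2, D α' (-y) (ψ.toLp 2)⟫_ℂ

/-- There is at most one such operator. -/
lemma IsBifractionalDisplacement.unique {α β θ₁ θ₂ : ℝ} {S T : H →L[ℂ] H}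
    (hS : IsBifractionalDisplacement α β θ₁ θ₂ S)
    (hT : IsBifractionalDisplacement α β θ₁ θ₂ T) : S = T := by
  have hd : DenseRange (fun f : 𝓢(ℝ, ℂ) => (f.toLp 2 : H)) :=
    SchwartzMap.denseRange_toLpCLM (E := ℝ) (F := ℂ) (p := 2) (μ := volume) (by simp)
  have key : (S : H → H) = T := by
    refine hd.equalizer S.continuous T.continuous (funext fun ψ => ?_)
    refine ext_inner_left ℂ fun v => ?_
    have hS' : Continuous fun v : H => ⟪v, S (ψ.toLp 2)⟫_ℂ := by fun_prop
    have hT' : Continuous fun v : H => ⟪v, T (ψ.toLp 2)⟫_ℂ := by fun_prop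
    exact congrFun (DenseRange.equalizer hd hS' hT'
      (funext fun φ => (hS φ ψ).trans (hT φ ψ).symm)) v
  exact DFunLike.coe_injective key

open Classical in
/-- The bifractional displacement operator `U(α, β; θ₁, θ₂)` (and `0` if the integral that defines
it does not define a bounded operator). -/
noncomputable def U (α β θ₁ θ₂ : ℝ) : H →L[ℂ] H :=
  if h : ∃ T : H →L[ℂ] H, IsBifractionalDisplacement α β θ₁ θ₂ T then h.choose else 0

/-! ### Trace class operators and the trace -/

/-- `T` is a trace class (nuclear) operator: `T = ∑ₙ |uₙ⟩⟨vₙ|` with `∑ₙ ‖uₙ‖ ‖vₙ‖ < ∞`. -/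
def IsTraceClass (T : H →L[ℂ] H) : Prop :=
  ∃ u v : ℕ → H, Summable (fun n => ‖u n‖ * ‖v n‖) ∧
    ∀ x : H, HasSum (fun n => ⟪v n, x⟫_ℂ • u n) (T x)

/-- A set that indexes an orthonormal basis of `L²(ℝ)`. -/
noncomputable def basisIndex : Set H := (exists_hilbertBasis ℂ H).choose

/-- An orthonormal basis of `L²(ℝ)`. -/
noncomputable def basis : HilbertBasis basisIndex ℂ H := (exists_hilbertBasis ℂ H).choose_spec.choose

/-- The trace `Tr T = ∑ᵢ ⟪eᵢ, T eᵢ⟫` of a trace class operator. -/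
noncomputable def Tr (T : H →L[ℂ] H) : ℂ := ∑' i, ⟪basis i, T (basis i)⟫_ℂ

lemma hasSum_inner_of_nuclear {ι : Type*} (b : HilbertBasis ι ℂ H) {T : H →L[ℂ] H} {u v : ℕ → H}
    (hs : Summable fun n => ‖u n‖ * ‖v n‖)
    (hT : ∀ x : H, HasSum (fun n => ⟪v n, x⟫_ℂ • u n) (T x)) :
    HasSum (fun i => ⟪b i, T (b i)⟫_ℂ) (∑' n, ⟪v n, u n⟫_ℂ) := by
  have hrow : ∀ n, HasSum (fun i => ⟪v n, b i⟫_ℂ * ⟪b i, u n⟫_ℂ) ⟪v n, u n⟫_ℂ :=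
    fun n => b.hasSum_inner_mul_inner _ _
  have hbound : ∀ n, ∑' i, ‖⟪v n, b i⟫_ℂ * ⟪b i, u n⟫_ℂ‖ ≤ ‖u n‖ * ‖v n‖ := by
    intro n
    refine (hrow n).summable.norm.tsum_le_of_sum_le fun s => ?_
    have h1 : ∑ i ∈ s, ‖⟪v n, b i⟫_ℂ‖ ^ 2 ≤ ‖v n‖ ^ 2 := by
      simpa only [norm_inner_symm] using b.orthonormal.sum_inner_products_le (v n) (s := s)
    have h2 : ∑ i ∈ s, ‖⟪b i, u n⟫_ℂ‖ ^ 2 ≤ ‖u n‖ ^ 2 :=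
      b.orthonormal.sum_inner_products_le (u n)
    calc ∑ i ∈ s, ‖⟪v n, b i⟫_ℂ * ⟪b i, u n⟫_ℂ‖
        = ∑ i ∈ s, ‖⟪v n, b i⟫_ℂ‖ * ‖⟪b i, u n⟫_ℂ‖ := by simp only [norm_mul]
      _ ≤ √(∑ i ∈ s, ‖⟪v n, b i⟫_ℂ‖ ^ 2) * √(∑ i ∈ s, ‖⟪b i, u n⟫_ℂ‖ ^ 2) :=
          Real.sum_mul_le_sqrt_mul_sqrt _ _ _
      _ ≤ ‖v n‖ * ‖u n‖ := by
          gcongr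
          · exact Real.sqrt_le_iff.2 ⟨norm_nonneg _, h1⟩
          · exact Real.sqrt_le_iff.2 ⟨norm_nonneg _, h2⟩
      _ = ‖u n‖ * ‖v n‖ := mul_comm _ _
  have hsum : Summable fun p : ℕ × ι => ⟪v p.1, b p.2⟫_ℂ * ⟪b p.2, u p.1⟫_ℂ := by
    refine Summable.of_norm ((summable_prod_of_nonneg fun _ => norm_nonneg _).2
      ⟨fun n => (hrow n).summable.norm, ?_⟩)
    exact Summable.of_nonneg_of_le (fun n => tsum_nonneg fun _ => norm_nonneg _) hbound hs
  have htot : HasSum (fun p : ℕ × ι => ⟪v p.1, b p.2⟫_ℂ * ⟪b p.2, u p.1⟫_ℂ)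
      (∑' n, ⟪v n, u n⟫_ℂ) := by
    have h := hsum.hasSum
    rwa [← (h.prod_fiberwise hrow).tsum_eq] at h
  refine ((Equiv.prodComm ι ℕ).hasSum_iff.2 htot).prod_fiberwise fun i => ?_
  have h := (hT (b i)).mapL (innerSL ℂ (b i))
  simpa [innerSL_apply_apply, inner_smul_right] using h

/-- The sum that defines the trace converges, and the trace does not depend on the basis. -/
lemma IsTraceClass.hasSum_Tr {T : H →L[ℂ] H} (hT : IsTraceClass T) {ι : Type*}
    (b : HilbertBasis ι ℂ H) : HasSum (fun i => ⟪b i, T (b i)⟫_ℂ) (Tr T) := by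
  obtain ⟨u, v, hs, hT⟩ := hT
  have h := hasSum_inner_of_nuclear b hs hT
  rwa [← (hasSum_inner_of_nuclear basis hs hT).tsum_eq] at h

/-- Products of a trace class operator with bounded operators are trace class. -/
lemma IsTraceClass.mul_right {T : H →L[ℂ] H} (hT : IsTraceClass T) (S : H →L[ℂ] H) :
    IsTraceClass (T * S) := by
  obtain ⟨u, v, hs, hT⟩ := hT
  refine ⟨u, fun n => S.adjoint (v n), ?_, fun x => ?_⟩
  · refine Summable.of_nonneg_of_le (fun n => by positivity) (fun n => ?_) (hs.mul_right ‖S.adjoint‖)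
    calc ‖u n‖ * ‖S.adjoint (v n)‖ ≤ ‖u n‖ * (‖S.adjoint‖ * ‖v n‖) := by
          gcongr; exact S.adjoint.le_opNorm _
      _ = ‖u n‖ * ‖v n‖ * ‖S.adjoint‖ := by ring
  · simpa only [ContinuousLinearMap.adjoint_inner_left,
      mul_apply_eq_comp] using hT (S x)

lemma IsTraceClass.mul_left {T : H →L[ℂ] H} (hT : IsTraceClass T) (S : H →L[ℂ] H) :
    IsTraceClass (S * T) := by
  obtain ⟨u, v, hs, hT⟩ := hT
  refine ⟨fun n => S (u n), v, ?_, fun x => ?_⟩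
  · refine Summable.of_nonneg_of_le (fun n => by positivity) (fun n => ?_) (hs.mul_left ‖S‖)
    calc ‖S (u n)‖ * ‖v n‖ ≤ (‖S‖ * ‖u n‖) * ‖v n‖ := by
          gcongr; exact S.le_opNorm _
      _ = ‖S‖ * (‖u n‖ * ‖v n‖) := by ring
  · simpa only [map_smul, mul_apply_eq_comp] using (hT x).mapL S

/-! ### Bifractional Wigner functions -/

/-- The bifractional Wigner function `A(α, β; θ₁, θ₂ | Θ) = Tr(Θ U(α, β; θ₁, θ₂))`. -/
noncomputable def A (α β θ₁ θ₂ : ℝ) (Θ : H →L[ℂ] H) : ℂ :=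
  Tr (Θ * U α β θ₁ θ₂)

/-- `A†(α, β; θ₁, θ₂ | Θ) = Tr(Θ U†(α, β; θ₁, θ₂))`. -/
noncomputable def Adag (α β θ₁ θ₂ : ℝ) (Θ : H →L[ℂ] H) : ℂ :=
  Tr (Θ * (U α β θ₁ θ₂).adjoint)

lemma Tr_mul_comm {T : H →L[ℂ] H} (hT : IsTraceClass T) (S : H →L[ℂ] H) :
    Tr (T * S) = Tr (S * T) := by
  obtain ⟨u, v, hs, hT⟩ := hT
  have h1 : HasSum (fun i => ⟪basis i, (T * S) (basis i)⟫_ℂ) (∑' n, ⟪S.adjoint (v n), u n⟫_ℂ) := by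
    refine hasSum_inner_of_nuclear basis (v := fun n => S.adjoint (v n)) ?_ fun x => ?_
    · refine Summable.of_nonneg_of_le (fun n => by positivity) (fun n => ?_)
        (hs.mul_right ‖S.adjoint‖)
      calc ‖u n‖ * ‖S.adjoint (v n)‖ ≤ ‖u n‖ * (‖S.adjoint‖ * ‖v n‖) := by
            gcongr; exact S.adjoint.le_opNorm _
        _ = ‖u n‖ * ‖v n‖ * ‖S.adjoint‖ := by ring
    · simpa only [ContinuousLinearMap.adjoint_inner_left,
        mul_apply_eq_comp] using hT (S x)
  have h2 : HasSum (fun i => ⟪basis i, (S * T) (basis i)⟫_ℂ) (∑' n, ⟪v n, S (u n)⟫_ℂ) := by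
    refine hasSum_inner_of_nuclear basis (u := fun n => S (u n)) ?_ fun x => ?_
    · refine Summable.of_nonneg_of_le (fun n => by positivity) (fun n => ?_) (hs.mul_left ‖S‖)
      calc ‖S (u n)‖ * ‖v n‖ ≤ (‖S‖ * ‖u n‖) * ‖v n‖ := by
            gcongr; exact S.le_opNorm _
        _ = ‖S‖ * (‖u n‖ * ‖v n‖) := by ring
    · simpa only [map_smul, mul_apply_eq_comp] using (hT x).mapL S
  rw [Tr, Tr, h1.tsum_eq, h2.tsum_eq]
  simp only [ContinuousLinearMap.adjoint_inner_left]

/-- For self-adjoint `Θ`, such as a density matrix, `A†` is the complex conjugate of `A`. -/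
lemma Adag_eq_conj_A (α β θ₁ θ₂ : ℝ) {Θ : H →L[ℂ] H} (hΘ : IsTraceClass Θ)
    (hsa : Θ.adjoint = Θ) : Adag α β θ₁ θ₂ Θ = starRingEnd ℂ (A α β θ₁ θ₂ Θ) := by
  rw [Adag, Tr_mul_comm hΘ, A, Tr, Tr, Complex.conj_tsum]
  refine tsum_congr fun i => ?_
  rw [inner_conj_symm, mul_apply_eq_comp, mul_apply_eq_comp,
    ContinuousLinearMap.adjoint_inner_right]
  nth_rw 1 [← hsa]
  rw [ContinuousLinearMap.adjoint_inner_right]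

end Bifractional

open Bifractional

namespace Bifractional

open Complex FourierTransform Filter Topology
open scoped ENNReal ContDiff

/-! ### Plancherel's theorem for the fractional Fourier transform -/

/-! Between Schwartz functions `φ`, `ψ`, the matrix elements of `D a (-y)` form an ambiguity
function: up to a phase, for each `a`, a dilated Fourier transform in `y` of `conj φ(x) ψ(x - √2
a)`. The matrix elements of `U` are `|cos(θ₁ - θ₂)|^{1/2}` times its fractional Fourier transforms,
of angle `θ₁` in `y` and then `θ₂` in `a`. Each transform is a chirp, a dilated Fourier transform
and a chirp, so it preserves the `L²` norm. Hence `∫ |⟪φ, U ψ⟫|² = π |cos(θ₁ - θ₂)| ‖φ‖² ‖ψ‖²`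
(`lintegral_inner_U_schwartz_sq`).

Density and polarization turn this into the orthogonality relations `∫ conj ⟪a, U b⟫ ⟪c, U d⟫ = C
⟪c, a⟫ ⟪b, d⟫` with `C = π |cos(θ₁ - θ₂)|` on all of `H` (`exists_sesquilinear_of_denseRange`). For
nuclear operators, `A` and the conjugate of `A†` are norm convergent series of such matrix elements
in `L²(ℝ²)`, and both formulas follow by pairing the series term by term.

Boundedness of `U` comes from an explicit evaluation. A Fresnel integral does the `θ₁` transform;
what remains is generically an operator with kernel `exp(i · quadratic)`, whose cross coefficient is
`cos(θ₁ - θ₂) / (2 cos θ₁ sin θ₂)`. It is a Fourier transform between phases, up to dilation. If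
`cos θ₁ = 0` or `sin θ₂ = 0`, it degenerates to a phase times a reflection or a translation. -/

lemma norm_phase (r : ℝ) : ‖exp (I * (r : ℂ))‖ = 1 := by
  rw [mul_comm, norm_exp_ofReal_mul_I]

lemma enorm_phase (r : ℝ) : ‖exp (I * (r : ℂ))‖ₑ = 1 := by
  rw [← ofReal_norm, norm_phase, ENNReal.ofReal_one]

lemma integrable_exp_mul {X : Type*} [MeasurableSpace X] {μ : Measure X} {f : X → ℂ}
    (hf : Integrable f μ) {g : X → ℝ} (hg : Measurable g) :
    Integrable (fun x => exp (I * (g x : ℂ)) * f x) μ := by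
  refine hf.bdd_mul (c := 1) ?_ (Eventually.of_forall fun x => (norm_phase _).le)
  exact (by fun_prop : Measurable fun x => exp (I * (g x : ℂ))).aestronglyMeasurable

lemma eLpNorm_two_sq {X : Type*} [MeasurableSpace X] {μ : Measure X} (f : X → ℂ) :
    eLpNorm f 2 μ ^ 2 = ∫⁻ x, ‖f x‖ₑ ^ 2 ∂μ := by
  have := eLpNorm_nnreal_pow_eq_lintegral (μ := μ) (f := f) (p := 2) two_ne_zero
  simpa using this

lemma enorm_sq_eq_lintegral {X : Type*} [MeasurableSpace X] {μ : Measure X} (f : Lp ℂ 2 μ) :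
    ‖f‖ₑ ^ 2 = ∫⁻ x, ‖f x‖ₑ ^ 2 ∂μ := by
  rw [Lp.enorm_def, eLpNorm_two_sq]

lemma lintegral_comp_mul_left (f : ℝ → ℝ≥0∞) {a : ℝ} (ha : a ≠ 0) :
    ∫⁻ x, f (a * x) = ENNReal.ofReal |a⁻¹| * ∫⁻ x, f x := by
  have h := lintegral_map_equiv (μ := volume) f (Homeomorph.mulLeft₀ a ha).toMeasurableEquiv
  rw [Homeomorph.toMeasurableEquiv_coe, Homeomorph.coe_mulLeft₀, Real.map_volume_mul_left ha,
    lintegral_smul_measure, smul_eq_mul] at h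
  exact h.symm

/-- The Fourier transform on `L²` agrees with the Fourier integral on `L¹ ∩ L²`. -/
lemma coeFn_fourier_toLp {f : ℝ → ℂ} (h1 : Integrable f) (h2 : MemLp f 2) :
    (𝓕 (h2.toLp f) : Lp ℂ 2 (volume : Measure ℝ)) =ᵐ[volume] 𝓕 f := by
  have hcont : Continuous (𝓕 f) :=
    VectorFourier.fourierIntegral_continuous (L := innerₗ ℝ) Real.continuous_fourierChar
      continuous_inner h1
  -- Both sides are tested against smooth compactly supported functions: as tempered distributions
  -- both move the Fourier transform onto the test function.
  refine ae_eq_of_integral_contDiff_smul_eq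
    ((Lp.memLp _).locallyIntegrable (by norm_num)) hcont.locallyIntegrable fun g hg hgs => ?_
  have hg₁ : HasCompactSupport (Complex.ofRealCLM ∘ g) := hgs.comp_left rfl
  have hg₂ : ContDiff ℝ ∞ (Complex.ofRealCLM ∘ g) := by fun_prop
  set G : 𝓢(ℝ, ℂ) := hg₁.toSchwartzMap hg₂ with hG
  have hGg : ∀ x, G x = g x := fun x => rfl
  calc ∫ x, g x • (𝓕 (h2.toLp f) : Lp ℂ 2 (volume : Measure ℝ)) x
      = Lp.toTemperedDistribution (𝓕 (h2.toLp f)) G := by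
        simp [hGg]
    _ = ∫ x, 𝓕 G x • f x := by
        rw [← Lp.fourier_toTemperedDistribution_eq, TemperedDistribution.fourier_apply,
          Lp.toTemperedDistribution_apply]
        refine integral_congr_ae ?_
        filter_upwards [h2.coeFn_toLp] with x hx
        rw [hx]
    _ = ∫ x, G x • 𝓕 f x := by
        simpa using! VectorFourier.integral_bilin_fourierIntegral_eq_flip
          (ContinuousLinearMap.lsmul ℂ ℂ) (L := innerₗ ℝ) Real.continuous_fourierChar
          continuous_inner G.integrable h1
    _ = ∫ x, g x • 𝓕 f x := by simp [hGg]

lemma lintegral_enorm_fourier_sq {f : ℝ → ℂ} (h1 : Integrable f) (h2 : MemLp f 2) :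
    ∫⁻ x, ‖𝓕 f x‖ₑ ^ 2 = ∫⁻ x, ‖f x‖ₑ ^ 2 := by
  rw [← eLpNorm_two_sq, ← eLpNorm_two_sq, ← eLpNorm_congr_ae (coeFn_fourier_toLp h1 h2),
    ← Lp.enorm_def, ← ofReal_norm, Lp.norm_fourier_eq, ofReal_norm, Lp.enorm_def,
    eLpNorm_congr_ae h2.coeFn_toLp]

lemma integral_exp_mul_eq_fourier (f : ℝ → ℂ) (s : ℝ) :
    ∫ y : ℝ, exp (I * ((s * y : ℝ) : ℂ)) * f y = 𝓕 f (-s / (2 * Real.pi)) := by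
  rw [Real.fourier_real_eq_integral_exp_smul]
  refine integral_congr_ae (Eventually.of_forall fun y => ?_)
  have : (-2 * Real.pi * y * (-s / (2 * Real.pi)) : ℝ) = s * y := by
    have := Real.pi_ne_zero
    field_simp
  simp only [this, smul_eq_mul, mul_comm I]

/-- The prefactor of the kernel `Δ`. -/
noncomputable def coeffΔ (θ : ℝ) : ℂ :=
  ((1 + I * (Real.cot θ : ℂ)) / (2 * (Real.pi : ℂ))) ^ (1 / 2 : ℂ)

/-- Because `1 + i cot θ = i e^{-iθ} / sin θ`; squaring removes the root, so its branch plays no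
role. -/
lemma norm_coeffΔ_sq {θ : ℝ} (h : Real.sin θ ≠ 0) :
    ‖coeffΔ θ‖ ^ 2 = 1 / (2 * Real.pi * |Real.sin θ|) := by
  have h1 : ‖1 + I * (Real.cot θ : ℂ)‖ = 1 / |Real.sin θ| := by
    have e : (1 + I * (Real.cot θ : ℂ)) =
        I * exp (I * ((-θ : ℝ) : ℂ)) / (Real.sin θ : ℂ) := by
      have h' : (Real.sin θ : ℂ) ≠ 0 := by exact_mod_cast h
      rw [mul_comm I ((-θ : ℝ) : ℂ), exp_mul_I, Real.cot_eq_cos_div_sin]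
      push_cast at h' ⊢
      field_simp
      simp only [Complex.cos_neg, Complex.sin_neg]
      linear_combination (Complex.sin θ) * I_sq
    rw [e, norm_div, norm_mul, norm_I, norm_phase, one_mul,
      Complex.norm_real, Real.norm_eq_abs]
  rw [← norm_pow, coeffΔ, ← cpow_nat_mul]
  have h2 : ((2 : ℕ) : ℂ) * (1 / 2) = 1 := by norm_num
  rw [h2, cpow_one, norm_div, h1, norm_mul, Complex.norm_two, Complex.norm_real, Real.norm_eq_abs,
    abs_of_pos Real.pi_pos]
  field_simp

lemma Δ_eq (x y θ : ℝ) : Δ x y θ = coeffΔ θ * exp (I *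
    ((-((x ^ 2 + y ^ 2) * Real.cot θ / 2) + x * y / Real.sin θ : ℝ) : ℂ)) := rfl

lemma integralΔ_of_sin_eq_zero {θ : ℝ} (h : Real.sin θ = 0) (x : ℝ) (f : ℝ → ℂ) :
    integralΔ x θ f = f (Real.cos θ * x) := if_pos h

lemma integralΔ_of_sin_ne_zero {θ : ℝ} (h : Real.sin θ ≠ 0) (x : ℝ) (f : ℝ → ℂ) :
    integralΔ x θ f = ∫ y : ℝ, Δ x y θ * f y := if_neg h

/-- The exponent splits into a chirp in `x`, a chirp in `y` and the phase `x y / sin θ`, which is a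
Fourier character at frequency `-x / (2π sin θ)`. -/
lemma integralΔ_eq_fourier {θ : ℝ} (h : Real.sin θ ≠ 0) (x : ℝ) (f : ℝ → ℂ) :
    integralΔ x θ f = coeffΔ θ * exp (I * ((-(x ^ 2 * Real.cot θ / 2) : ℝ) : ℂ)) *
      𝓕 (fun y : ℝ => exp (I * ((-(y ^ 2 * Real.cot θ / 2) : ℝ) : ℂ)) * f y)
        (-(2 * Real.pi * Real.sin θ)⁻¹ * x) := by
  have : -(2 * Real.pi * Real.sin θ)⁻¹ * x = -(x / Real.sin θ) / (2 * Real.pi) := by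
    have := Real.pi_ne_zero
    field_simp
  rw [integralΔ_of_sin_ne_zero h, this, ← integral_exp_mul_eq_fourier, ← integral_const_mul]
  refine integral_congr_ae (Eventually.of_forall fun y => ?_)
  simp only [Δ_eq, mul_assoc]
  congr 1
  simp only [← mul_assoc, ← Complex.exp_add]
  congr 2
  push_cast
  ring

lemma integralΔ_const_mul (x θ : ℝ) (c : ℂ) (f : ℝ → ℂ) :
    integralΔ x θ (fun y => c * f y) = c * integralΔ x θ f := by
  by_cases h : Real.sin θ = 0
  · simp only [integralΔ_of_sin_eq_zero h]
  · simp only [integralΔ_of_sin_ne_zero h, ← integral_const_mul]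
    simp only [mul_left_comm]

/-- The fractional Fourier transform preserves the `L²` norm. -/
lemma lintegral_enorm_integralΔ_sq (θ : ℝ) {f : ℝ → ℂ} (h1 : Integrable f) (h2 : MemLp f 2) :
    ∫⁻ x, ‖integralΔ x θ f‖ₑ ^ 2 = ∫⁻ x, ‖f x‖ₑ ^ 2 := by
  by_cases h : Real.sin θ = 0
  · simp only [integralΔ_of_sin_eq_zero h]
    have hc : |Real.cos θ| = 1 := (abs_eq zero_le_one).2 (Real.sin_eq_zero_iff_cos_eq.1 h)
    have hc0 : Real.cos θ ≠ 0 := by rw [← abs_pos, hc]; exact one_pos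
    rw [lintegral_comp_mul_left (fun x => ‖f x‖ₑ ^ 2) hc0, abs_inv, hc]
    simp
  · have hpi := Real.pi_pos
    set g : ℝ → ℂ := fun y => exp (I * ((-(y ^ 2 * Real.cot θ / 2) : ℝ) : ℂ)) * f y with hg
    have hgn : ∀ y, ‖g y‖ = ‖f y‖ := fun y => by
      rw [hg, norm_mul, norm_phase, one_mul]
    have hgi : Integrable g := integrable_exp_mul h1 (by fun_prop)
    have hg2 : MemLp g 2 := h2.congr_norm hgi.1 (Eventually.of_forall fun y => (hgn y).symm)
    simp only [integralΔ_eq_fourier h, enorm_mul, enorm_phase, mul_one, mul_pow]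
    rw [lintegral_const_mul' _ _ (by finiteness),
      lintegral_comp_mul_left (fun x => ‖𝓕 g x‖ₑ ^ 2) (neg_ne_zero.2 (by positivity)),
      lintegral_enorm_fourier_sq hgi hg2, ← mul_assoc, ← ofReal_norm,
      ← ENNReal.ofReal_pow (norm_nonneg _), norm_coeffΔ_sq h, ← ENNReal.ofReal_mul (by positivity)]
    -- The Jacobian of the dilation cancels the squared modulus of the prefactor.
    have : 1 / (2 * Real.pi * |Real.sin θ|) * |(-(2 * Real.pi * Real.sin θ)⁻¹)⁻¹| = 1 := by
      rw [inv_neg, inv_inv, abs_neg, abs_mul, abs_of_pos (by positivity : 0 < 2 * Real.pi)]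
      have := abs_pos.2 h
      field_simp
    rw [this, ENNReal.ofReal_one, one_mul]
    exact lintegral_congr fun y => by rw [← ofReal_norm, hgn, ofReal_norm]

/-! ### Weighted affine changes of variables -/

lemma quasiMeasurePreserving_affine {r : ℝ} (hr : r ≠ 0) (t : ℝ) :
    Measure.QuasiMeasurePreserving (fun x : ℝ => r * x + t) := by
  have h : Measure.QuasiMeasurePreserving (fun x : ℝ => r * x) :=
    ⟨by fun_prop, by rw [Real.map_volume_mul_left hr]; exact Measure.smul_absolutelyContinuous⟩
  exact (measurePreserving_add_right volume t).quasiMeasurePreserving.comp h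

lemma lintegral_comp_affine (f : ℝ → ℝ≥0∞) {r : ℝ} (hr : r ≠ 0) (t : ℝ) :
    ∫⁻ x, f (r * x + t) = ENNReal.ofReal |r⁻¹| * ∫⁻ x, f x := by
  rw [lintegral_comp_mul_left (fun x => f (x + t)) hr, lintegral_add_right_eq_self f t]

lemma memLp_weighted_affine {g : ℝ → ℂ} (hg : Continuous g) (hg1 : ∀ x, ‖g x‖ = 1) {r : ℝ}
    (hr : r ≠ 0) (t : ℝ) (ψ : H) :
    MemLp (fun x => g x * ψ (r * x + t)) 2 volume := by
  refine ⟨hg.aestronglyMeasurable.mul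
    ((Lp.aestronglyMeasurable ψ).comp_quasiMeasurePreserving
      (quasiMeasurePreserving_affine hr t)), ?_⟩
  have h : eLpNorm (fun x => g x * ψ (r * x + t)) 2 volume ^ 2 < ⊤ := by
    rw [eLpNorm_two_sq]
    have : ∀ x, ‖g x * ψ (r * x + t)‖ₑ ^ 2 = ‖ψ (r * x + t)‖ₑ ^ 2 := fun x => by
      rw [enorm_mul, ← ofReal_norm (g x), hg1, ENNReal.ofReal_one, one_mul]
    simp only [this]
    rw [lintegral_comp_affine (fun x => ‖ψ x‖ₑ ^ 2) hr t, ← enorm_sq_eq_lintegral]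
    finiteness
  simpa using h

/-- The degenerate displacement operators are multiples of such operators, and the generic ones are
built from them and the Fourier transform. -/
lemma exists_weighted_affine {g : ℝ → ℂ} (hg : Continuous g) (hg1 : ∀ x, ‖g x‖ = 1) {r : ℝ}
    (hr : r ≠ 0) (t : ℝ) :
    ∃ T : H →L[ℂ] H, ∀ ψ : H, T ψ =ᵐ[volume] fun x => g x * ψ (r * x + t) := by
  let L : H →ₗ[ℂ] H :=
    { toFun := fun ψ => (memLp_weighted_affine hg hg1 hr t ψ).toLp
      map_add' := fun ψ φ => by
        rw [← MemLp.toLp_add, MemLp.toLp_eq_toLp_iff]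
        filter_upwards [(quasiMeasurePreserving_affine hr t).ae_eq (Lp.coeFn_add ψ φ)] with x hx
        simp only [Function.comp_apply, Pi.add_apply] at hx ⊢
        rw [hx, mul_add]
      map_smul' := fun c ψ => by
        rw [RingHom.id_apply, ← MemLp.toLp_const_smul, MemLp.toLp_eq_toLp_iff]
        filter_upwards [(quasiMeasurePreserving_affine hr t).ae_eq (Lp.coeFn_smul c ψ)] with x hx
        simp only [Function.comp_apply, Pi.smul_apply, smul_eq_mul] at hx ⊢
        rw [hx, mul_left_comm] }
  have hL : ∀ ψ, L ψ =ᵐ[volume] fun x => g x * ψ (r * x + t) := fun ψ =>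
    (memLp_weighted_affine hg hg1 hr t ψ).coeFn_toLp
  refine ⟨L.mkContinuous (√|r⁻¹|) fun ψ => ?_, hL⟩
  have h : ‖L ψ‖ₑ ^ 2 = ENNReal.ofReal |r⁻¹| * ‖ψ‖ₑ ^ 2 := by
    rw [enorm_sq_eq_lintegral, enorm_sq_eq_lintegral,
      ← lintegral_comp_affine (fun x => ‖ψ x‖ₑ ^ 2) hr t]
    refine lintegral_congr_ae ?_
    filter_upwards [hL ψ] with x hx
    rw [hx, enorm_mul, ← ofReal_norm (g x), hg1, ENNReal.ofReal_one, one_mul]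
  have h' : ‖L ψ‖ ^ 2 = |r⁻¹| * ‖ψ‖ ^ 2 := by
    have := congrArg ENNReal.toReal h
    simpa using this
  rw [← abs_of_nonneg (norm_nonneg (L ψ)), ← Real.sqrt_sq_eq_abs, h',
    Real.sqrt_mul (abs_nonneg _), Real.sqrt_sq (norm_nonneg _)]

/-! ### The ambiguity function of Schwartz functions -/

/-- The Schwartz function `x ↦ conj (φ x) * ψ (x - √2 a)`. -/
noncomputable def overlap (φ ψ : 𝓢(ℝ, ℂ)) (a : ℝ) : 𝓢(ℝ, ℂ) :=
  SchwartzMap.pairing (ContinuousLinearMap.mul ℝ ℂ)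
    (SchwartzMap.postcompCLM (𝕜 := ℝ) (Complex.conjCLE : ℂ →L[ℝ] ℂ) φ)
    (SchwartzMap.compSubConstCLM ℝ (√2 * a) ψ)

lemma overlap_apply (φ ψ : 𝓢(ℝ, ℂ)) (a x : ℝ) :
    overlap φ ψ a x = starRingEnd ℂ (φ x) * ψ (x - √2 * a) := rfl

lemma inner_toLp_eq (φ : 𝓢(ℝ, ℂ)) (f : H) :
    ⟪φ.toLp 2, f⟫_ℂ = ∫ x, starRingEnd ℂ (φ x) * f x := by
  rw [L2.inner_def]
  refine integral_congr_ae ?_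
  filter_upwards [φ.coeFn_toLp 2 volume] with x hx
  rw [hx, RCLike.inner_apply, mul_comm]

/-- `∫ exp(i y (a - √2 x)) q(x) dx`. -/
noncomputable def ambiguity (q : 𝓢(ℝ, ℂ)) (a y : ℝ) : ℂ :=
  ∫ x, exp (I * ((y * (a - √2 * x) : ℝ) : ℂ)) * q x

/-- `ambiguity` keeps `q` and `a` independent, so that the transform in `y` can be computed for an
arbitrary Schwartz function; here `q` depends on `a` too. -/
lemma inner_D_eq (φ ψ : 𝓢(ℝ, ℂ)) (a y : ℝ) :
    ⟪φ.toLp 2, D a (-y) (ψ.toLp 2)⟫_ℂ = ambiguity (overlap φ ψ a) a y := by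
  rw [inner_toLp_eq, ambiguity]
  refine integral_congr_ae ?_
  filter_upwards [coeFn_D a (-y) (ψ.toLp 2),
    displaceFun_congr a (-y) (ψ.coeFn_toLp 2 volume)] with x h1 h2
  rw [h1, h2, displaceFun, overlap_apply, mul_left_comm]
  congr 4
  ring

lemma ambiguity_eq_fourier (q : 𝓢(ℝ, ℂ)) (a y : ℝ) :
    ambiguity q a y = exp (I * ((a * y : ℝ) : ℂ)) * 𝓕 q ((√2 / (2 * Real.pi)) * y) := by
  have h : (√2 / (2 * Real.pi)) * y = -(-√2 * y) / (2 * Real.pi) := by ring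
  rw [SchwartzMap.fourier_coe, h, ← integral_exp_mul_eq_fourier, ambiguity, ← integral_const_mul]
  refine integral_congr_ae (Eventually.of_forall fun x => ?_)
  simp only [← mul_assoc, ← Complex.exp_add]
  congr 2
  push_cast
  ring

lemma integrable_ambiguity (q : 𝓢(ℝ, ℂ)) (a : ℝ) : Integrable (ambiguity q a) := by
  have h : Integrable fun y : ℝ => 𝓕 q ((√2 / (2 * Real.pi)) * y) :=
    (𝓕 q).integrable.comp_mul_left' (by have := Real.pi_pos; positivity)
  exact (integrable_exp_mul h (g := fun y => a * y) (by fun_prop)).congr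
    (Eventually.of_forall fun y => (ambiguity_eq_fourier q a y).symm)

lemma lintegral_enorm_ambiguity_sq (q : 𝓢(ℝ, ℂ)) (a : ℝ) :
    ∫⁻ y, ‖ambiguity q a y‖ₑ ^ 2 = ENNReal.ofReal (√2 * Real.pi) * ∫⁻ x, ‖q x‖ₑ ^ 2 := by
  have hpi := Real.pi_pos
  simp only [ambiguity_eq_fourier, enorm_mul, enorm_phase, one_mul]
  rw [lintegral_comp_mul_left (fun y => ‖𝓕 q y‖ₑ ^ 2) (by positivity : √2 / (2 * Real.pi) ≠ 0),
    SchwartzMap.fourier_coe, lintegral_enorm_fourier_sq q.integrable (q.memLp 2)]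
  congr 2
  rw [abs_of_pos (by positivity)]
  have : √2 ^ 2 = 2 := Real.sq_sqrt (by norm_num)
  field_simp
  linarith

lemma memLp_ambiguity (q : 𝓢(ℝ, ℂ)) (a : ℝ) : MemLp (ambiguity q a) 2 := by
  refine ⟨(integrable_ambiguity q a).1, ?_⟩
  have h : eLpNorm (ambiguity q a) 2 volume ^ 2 < ⊤ := by
    rw [eLpNorm_two_sq, lintegral_enorm_ambiguity_sq, ← eLpNorm_two_sq]
    have := (q.memLp 2 (volume : Measure ℝ)).2
    finiteness
  simpa using h

/-! ### The fractional Fourier transform of the ambiguity function -/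

/-- Fourier inversion: the case in which the fractional Fourier transform is the Fourier
transform. -/
lemma integralΔ_ambiguity_of_cos_eq_zero {θ : ℝ} (h : Real.cos θ = 0) (α : ℝ) (q : 𝓢(ℝ, ℂ))
    (a : ℝ) : integralΔ α θ (ambiguity q a) =
      (coeffΔ θ * (√2 * Real.pi : ℝ)) * q (a / √2 + Real.sin θ * α / √2) := by
  have hs2 : Real.sin θ ^ 2 = 1 := by
    have := Real.sin_sq_add_cos_sq θ
    rw [h] at this
    linarith
  have hs : Real.sin θ ≠ 0 := fun h0 => by simp [h0] at hs2
  have hinv : 1 / Real.sin θ = Real.sin θ := by field_simp; exact hs2.symm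
  have hpi := Real.pi_pos
  have h2 : √2 ^ 2 = 2 := Real.sq_sqrt (by norm_num)
  have hF : 𝓕⁻ (𝓕 q) (a / √2 + Real.sin θ * α / √2) = q (a / √2 + Real.sin θ * α / √2) := by
    rw [FourierTransform.fourierInv_fourier_eq]
  rw [← hF, integralΔ_of_sin_ne_zero hs, SchwartzMap.fourierInv_coe, Real.fourierInv_eq',
    mul_assoc]
  -- The constant is the Jacobian of the dilation `y ↦ √2 y / (2π)` in `ambiguity_eq_fourier`.
  have hk : (√2 * Real.pi : ℝ) = |(√2 / (2 * Real.pi))⁻¹| := by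
    rw [abs_of_pos (by positivity)]
    field_simp
    linarith
  rw [hk, ← Complex.real_smul, ← Measure.integral_comp_mul_left, ← integral_const_mul]
  refine integral_congr_ae (Eventually.of_forall fun y => ?_)
  simp only [ambiguity_eq_fourier, Δ_eq, smul_eq_mul, ← mul_assoc]
  rw [mul_assoc (coeffΔ θ), ← Complex.exp_add]
  congr 3
  rw [Real.cot_eq_cos_div_sin, h, ← mul_add, mul_comm I, ← ofReal_add]
  congr 2
  simp only [RCLike.inner_apply, conj_trivial, zero_div, mul_zero, neg_zero, zero_add]
  have hy : α * y / Real.sin θ = α * y * Real.sin θ := by rw [div_eq_mul_one_div, hinv]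
  rw [hy]
  field_simp
  ring

/-- The Fresnel integral formula, regularised by a Gaussian factor. -/
lemma integral_gaussian_mul_ambiguity (q : 𝓢(ℝ, ℂ)) (a s : ℝ) {b : ℂ} (hb : 0 < b.re) :
    ∫ y : ℝ, exp (-b * y ^ 2) * (exp (I * ((s * y : ℝ) : ℂ)) * ambiguity q a y) =
      (Real.pi / b) ^ (1 / 2 : ℂ) *
        ∫ x : ℝ, exp (-((s + (a - √2 * x) : ℝ) : ℂ) ^ 2 / (4 * b)) * q x := by
  have hg : Integrable fun y : ℝ => exp (-b * y ^ 2) := integrable_cexp_neg_mul_sq hb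
  -- The Gaussian factor supplies the decay in `y` that Fubini needs.
  have hint : Integrable (Function.uncurry fun y x : ℝ =>
      exp (I * ((s * y + y * (a - √2 * x) : ℝ) : ℂ)) * (exp (-b * y ^ 2) * q x))
      (volume.prod volume) :=
    integrable_exp_mul (hg.mul_prod q.integrable)
      (g := fun p : ℝ × ℝ => s * p.1 + p.1 * (a - √2 * p.2)) (by fun_prop)
  calc ∫ y : ℝ, exp (-b * y ^ 2) * (exp (I * ((s * y : ℝ) : ℂ)) * ambiguity q a y)
      = ∫ y : ℝ, ∫ x : ℝ,
          exp (I * ((s * y + y * (a - √2 * x) : ℝ) : ℂ)) * (exp (-b * y ^ 2) * q x) := by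
        refine integral_congr_ae (Eventually.of_forall fun y => ?_)
        simp only [ambiguity, ← integral_const_mul]
        refine integral_congr_ae (Eventually.of_forall fun x => ?_)
        simp only [← mul_assoc, ← Complex.exp_add]
        congr 2
        push_cast
        ring
    _ = ∫ x : ℝ, ∫ y : ℝ,
          exp (I * ((s * y + y * (a - √2 * x) : ℝ) : ℂ)) * (exp (-b * y ^ 2) * q x) :=
        integral_integral_swap hint
    _ = _ := by
        rw [← integral_const_mul]
        refine integral_congr_ae (Eventually.of_forall fun x => ?_)
        simp only [← mul_assoc]
        rw [integral_mul_const, ← fourierIntegral_gaussian hb]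
        congr 1
        refine integral_congr_ae (Eventually.of_forall fun y => ?_)
        simp only
        congr 2
        push_cast
        ring

/-- `1 / b` has nonnegative real part along with `b`. This gives a bound uniform in the
regularisation. -/
lemma norm_exp_neg_sq_div_le_one {b : ℂ} (hb : 0 ≤ b.re) (t : ℝ) :
    ‖exp (-(t : ℂ) ^ 2 / (4 * b))‖ ≤ 1 := by
  rw [Complex.norm_exp, Real.exp_le_one_iff]
  have h : -(t : ℂ) ^ 2 / (4 * b) = ((-(t ^ 2 / 4) : ℝ) : ℂ) * b⁻¹ := by
    push_cast
    rw [div_eq_mul_inv, mul_inv]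
    ring
  rw [h, re_ofReal_mul, inv_re]
  have : 0 ≤ b.re / normSq b := div_nonneg hb (normSq_nonneg b)
  nlinarith [sq_nonneg t]

/-- The Fresnel integral formula. -/
lemma integral_fresnel_mul_ambiguity (q : 𝓢(ℝ, ℂ)) (a s : ℝ) {c : ℝ} (hc : c ≠ 0) :
    ∫ y : ℝ, exp (-(I * c) * y ^ 2) * (exp (I * ((s * y : ℝ) : ℂ)) * ambiguity q a y) =
      (Real.pi / (I * c)) ^ (1 / 2 : ℂ) *
        ∫ x : ℝ, exp (-((s + (a - √2 * x) : ℝ) : ℂ) ^ 2 / (4 * (I * c))) * q x := by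
  have hc' : (c : ℂ) ≠ 0 := by exact_mod_cast hc
  have hb0 : I * (c : ℂ) ≠ 0 := mul_ne_zero I_ne_zero hc'
  -- The regularised formula is used at `b = ε + i c`; both sides converge as `ε → 0+` by dominated
  -- convergence.
  have hb : Tendsto (fun ε : ℝ => (ε : ℂ) + I * c) (𝓝[>] 0) (𝓝 (I * c)) := by
    have : Continuous fun ε : ℝ => (ε : ℂ) + I * c := by fun_prop
    have h := this.tendsto 0
    simp only [ofReal_zero, zero_add] at h
    exact h.mono_left nhdsWithin_le_nhds
  have hre : ∀ ε : ℝ, ((ε : ℂ) + I * c).re = ε := fun ε => by simp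
  have hL : Tendsto (fun ε : ℝ => ∫ y : ℝ, exp (-((ε : ℂ) + I * c) * y ^ 2) *
      (exp (I * ((s * y : ℝ) : ℂ)) * ambiguity q a y)) (𝓝[>] 0)
      (𝓝 (∫ y : ℝ, exp (-(I * c) * y ^ 2) *
        (exp (I * ((s * y : ℝ) : ℂ)) * ambiguity q a y))) := by
    have hi := integrable_exp_mul (integrable_ambiguity q a) (g := fun y => s * y) (by fun_prop)
    refine tendsto_integral_filter_of_dominated_convergence (fun y => ‖ambiguity q a y‖)
      (Eventually.of_forall fun ε => ?_) ?_ (integrable_ambiguity q a).norm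
      (Eventually.of_forall fun y => ?_)
    · exact (by fun_prop : Continuous fun y : ℝ =>
        exp (-((ε : ℂ) + I * c) * y ^ 2)).aestronglyMeasurable.mul hi.1
    · filter_upwards [self_mem_nhdsWithin] with ε hε
      refine Eventually.of_forall fun y => ?_
      rw [norm_mul, norm_mul, norm_phase, one_mul]
      refine mul_le_of_le_one_left (norm_nonneg _) ?_
      rw [Complex.norm_exp, Real.exp_le_one_iff, ← ofReal_pow, re_mul_ofReal, neg_re, hre]
      have : 0 < ε := hε
      nlinarith [sq_nonneg y]
    · refine Tendsto.mul_const _ ?_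
      exact (Complex.continuous_exp.tendsto _).comp (hb.neg.mul_const _)
  have hR : Tendsto (fun ε : ℝ => (Real.pi / ((ε : ℂ) + I * c)) ^ (1 / 2 : ℂ) *
      ∫ x : ℝ, exp (-((s + (a - √2 * x) : ℝ) : ℂ) ^ 2 / (4 * ((ε : ℂ) + I * c))) * q x) (𝓝[>] 0)
      (𝓝 ((Real.pi / (I * c)) ^ (1 / 2 : ℂ) *
        ∫ x : ℝ, exp (-((s + (a - √2 * x) : ℝ) : ℂ) ^ 2 / (4 * (I * c))) * q x)) := by
    refine Tendsto.mul ?_ ?_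
    -- The limit is a nonzero imaginary number, off the branch cut, so the principal root is
    -- continuous there.
    · have hslit : (Real.pi / (I * c) : ℂ) ∈ slitPlane := by
        refine Or.inr ?_
        have : (Real.pi / (I * c) : ℂ) = ((-(Real.pi / c) : ℝ) : ℂ) * I := by
          push_cast
          rw [mul_comm I, ← div_div, div_I]
          ring
        rw [this, im_ofReal_mul, I_im, mul_one]
        exact neg_ne_zero.2 (div_ne_zero Real.pi_ne_zero hc)
      exact ((continuousAt_cpow_const hslit).tendsto).comp (tendsto_const_nhds.div hb hb0)
    · refine tendsto_integral_filter_of_dominated_convergence (fun x => ‖q x‖)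
        (Eventually.of_forall fun ε => ?_) ?_ q.integrable.norm
        (Eventually.of_forall fun x => ?_)
      · exact (by fun_prop : Continuous fun x : ℝ => exp (-((s + (a - √2 * x) : ℝ) : ℂ) ^ 2 /
          (4 * ((ε : ℂ) + I * c))) * q x).aestronglyMeasurable
      · filter_upwards [self_mem_nhdsWithin] with ε hε
        refine Eventually.of_forall fun x => ?_
        rw [norm_mul]
        refine mul_le_of_le_one_left (norm_nonneg _) (norm_exp_neg_sq_div_le_one ?_ _)
        rw [hre]
        exact le_of_lt hε
      · refine Tendsto.mul_const _ ((Complex.continuous_exp.tendsto _).comp ?_)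
        exact tendsto_const_nhds.div (hb.const_mul 4) (mul_ne_zero (by norm_num) hb0)
  refine tendsto_nhds_unique hL (hR.congr' ?_)
  filter_upwards [self_mem_nhdsWithin] with ε hε
  exact (integral_gaussian_mul_ambiguity q a s (by rw [hre]; exact hε)).symm

/-- The Fresnel formula with `c = cot θ / 2` and `s = α / sin θ` yields the phase `(tan θ / 2) (s +
a - √2 x)²`, whose constant term goes into `k`. That `k` depends on neither `q` nor `a` lets it
leave the later integral over `a`. -/
lemma exists_integralΔ_ambiguity_of_cos_ne_zero {θ : ℝ} (h : Real.cos θ ≠ 0) (α : ℝ) :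
    ∃ k : ℂ, ∀ (q : 𝓢(ℝ, ℂ)) (a : ℝ), integralΔ α θ (ambiguity q a) =
      k * ∫ x, exp (I * ((Real.tan θ / 2 * (a - √2 * x) ^ 2 +
        α / Real.cos θ * (a - √2 * x) : ℝ) : ℂ)) * q x := by
  by_cases hs : Real.sin θ = 0
  · refine ⟨1, fun q a => ?_⟩
    have hc2 : Real.cos θ ^ 2 = 1 := by
      have := Real.sin_sq_add_cos_sq θ
      rw [hs] at this
      linarith
    have hinv : α / Real.cos θ = Real.cos θ * α := by
      field_simp
      rw [hc2, mul_one]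
    rw [integralΔ_of_sin_eq_zero hs, one_mul, ambiguity, Real.tan_eq_sin_div_cos, hs, hinv]
    simp
  · have hcot : Real.cot θ / 2 ≠ 0 := by
      rw [Real.cot_eq_cos_div_sin]
      positivity
    refine ⟨coeffΔ θ * exp (I * ((-(α ^ 2 * Real.cot θ / 2) : ℝ) : ℂ)) *
      ((Real.pi / (I * (Real.cot θ / 2 : ℝ))) ^ (1 / 2 : ℂ) *
        exp (I * ((Real.tan θ / 2 * (α / Real.sin θ) ^ 2 : ℝ) : ℂ))), fun q a => ?_⟩
    have hF := integral_fresnel_mul_ambiguity q a (α / Real.sin θ) hcot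
    rw [integralΔ_of_sin_ne_zero hs]
    trans coeffΔ θ * exp (I * ((-(α ^ 2 * Real.cot θ / 2) : ℝ) : ℂ)) *
      ∫ y : ℝ, exp (-(I * (Real.cot θ / 2 : ℝ)) * y ^ 2) *
        (exp (I * ((α / Real.sin θ * y : ℝ) : ℂ)) * ambiguity q a y)
    · rw [← integral_const_mul]
      refine integral_congr_ae (Eventually.of_forall fun y => ?_)
      simp only [Δ_eq, mul_assoc]
      congr 1
      simp only [← mul_assoc, ← Complex.exp_add]
      congr 2
      push_cast
      ring
    · rw [hF]
      simp only [mul_assoc]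
      congr 3
      rw [← integral_const_mul]
      refine integral_congr_ae (Eventually.of_forall fun x => ?_)
      simp only [← mul_assoc, ← Complex.exp_add]
      congr 2
      have hc' : (Real.cot θ : ℂ) = (Real.tan θ : ℂ)⁻¹ := by
        rw [← ofReal_inv, Real.tan_eq_sin_div_cos, Real.cot_eq_cos_div_sin, inv_div]
      have ht : (Real.tan θ : ℂ) ≠ 0 := by
        rw [Real.tan_eq_sin_div_cos]
        exact_mod_cast div_ne_zero hs h
      have hts : α / Real.cos θ = Real.tan θ * (α / Real.sin θ) := by
        rw [Real.tan_eq_sin_div_cos]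
        field_simp
      rw [hts]
      push_cast [hc']
      have hI := I_sq
      have hI0 := I_ne_zero
      field_simp
      rw [hI]
      ring

/-! ### Existence of the bifractional displacement operators -/

lemma integral_comp_affine (f : ℝ → ℂ) (r t : ℝ) :
    ∫ x, f (r * x + t) = ((|r⁻¹| : ℝ) : ℂ) * ∫ x, f x := by
  rw [Measure.integral_comp_mul_left (fun x => f (x + t)), integral_add_right_eq_self f t,
    Complex.real_smul]

lemma integrable_overlap (φ ψ : 𝓢(ℝ, ℂ)) :
    Integrable (Function.uncurry fun a x : ℝ => overlap φ ψ a x) (volume.prod volume) := by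
  have hs : (-√2 : ℝ) ≠ 0 := neg_ne_zero.2 (by positivity)
  have hφ := φ.continuous
  have hψ := ψ.continuous
  have haff : ∀ x a : ℝ, ψ (x - √2 * a) = ψ (-√2 * a + x) := fun x a => by congr 1; ring
  refine (integrable_prod_iff' ?_).2 ⟨Eventually.of_forall fun x => ?_, ?_⟩
  · refine Continuous.aestronglyMeasurable ?_
    simp only [Function.uncurry_def, overlap_apply]
    fun_prop
  · simp only [Function.uncurry_apply_pair, overlap_apply, haff]
    exact ((ψ.integrable.comp_add_right x).comp_mul_left' hs).const_mul _
  · have h : ∀ x : ℝ, ∫ a : ℝ, ‖Function.uncurry (fun a x : ℝ => overlap φ ψ a x) (a, x)‖ =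
        ‖φ x‖ * (|(-√2)⁻¹| * ∫ x, ‖ψ x‖) := fun x => by
      simp only [Function.uncurry_apply_pair, overlap_apply, haff, norm_mul, RCLike.norm_conj]
      rw [integral_const_mul, Measure.integral_comp_mul_left (fun a => ‖ψ (a + x)‖),
        integral_add_right_eq_self (fun a => ‖ψ a‖) x, smul_eq_mul]
    simp only [h]
    exact φ.integrable.norm.mul_const _

lemma inner_weighted_affine {g : ℝ → ℂ} {r t : ℝ} (hr : r ≠ 0) {T : H →L[ℂ] H}
    (hT : ∀ ψ : H, T ψ =ᵐ[volume] fun x => g x * ψ (r * x + t)) (φ : 𝓢(ℝ, ℂ)) {ψ : H}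
    {f : ℝ → ℂ} (hf : ψ =ᵐ[volume] f) :
    ⟪φ.toLp 2, T ψ⟫_ℂ = ∫ x, starRingEnd ℂ (φ x) * (g x * f (r * x + t)) := by
  rw [inner_toLp_eq]
  refine integral_congr_ae ?_
  filter_upwards [hT ψ, (quasiMeasurePreserving_affine hr t).ae_eq hf] with x h1 h2
  simp only [Function.comp_apply] at h2
  rw [h1, h2]

lemma continuous_exp_I_mul {p : ℝ → ℝ} (hp : Continuous p) :
    Continuous fun x => exp (I * (p x : ℂ)) := by fun_prop

/-- Fourier inversion evaluates the overlap at `x = a / √2 + u`, where `x - √2 a = 2 u - x`. The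
operator is thus a multiple of a phase times the reflection about `u`, the phase being that of the
`θ₂` kernel at `a = √2 (x - u)`. -/
lemma exists_displacement_of_cos_eq_zero {θ₁ θ₂ : ℝ} (h1 : Real.cos θ₁ = 0)
    (h2 : Real.sin θ₂ ≠ 0) (α β : ℝ) :
    ∃ T : H →L[ℂ] H, ∀ φ ψ : 𝓢(ℝ, ℂ), ⟪φ.toLp 2, T (ψ.toLp 2)⟫_ℂ =
      integralΔ β θ₂ fun a => integralΔ α θ₁ (ambiguity (overlap φ ψ a) a) := by
  set u := Real.sin θ₁ * α / √2 with hu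
  set p : ℝ → ℝ := fun x => -((β ^ 2 + (√2 * (x - u)) ^ 2) * Real.cot θ₂ / 2) +
    β * (√2 * (x - u)) / Real.sin θ₂ with hp
  obtain ⟨T, hT⟩ := exists_weighted_affine (continuous_exp_I_mul (p := p) (by fun_prop))
    (fun x => norm_phase _) (neg_ne_zero.2 one_ne_zero) (2 * u)
  have hs2 : √2 ^ 2 = 2 := Real.sq_sqrt (by norm_num)
  have hs0 : √2 ≠ 0 := by positivity
  refine ⟨(coeffΔ θ₁ * (√2 * Real.pi : ℝ) * (coeffΔ θ₂ * (√2 : ℝ))) • T, fun φ ψ => ?_⟩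
  simp only [integralΔ_ambiguity_of_cos_eq_zero h1, integralΔ_const_mul]
  rw [smul_apply, inner_smul_right,
    inner_weighted_affine (neg_ne_zero.2 one_ne_zero) hT φ (ψ.coeFn_toLp 2 volume), mul_assoc,
    integralΔ_of_sin_ne_zero h2]
  congr 1
  have hk : (√2 : ℝ) = |((√2)⁻¹)⁻¹| := by rw [inv_inv, abs_of_pos (by positivity)]
  rw [mul_assoc]
  nth_rw 1 [hk]
  rw [← integral_comp_affine _ _ u, ← integral_const_mul]
  refine integral_congr_ae (Eventually.of_forall fun a => ?_)
  simp only [Δ_eq, overlap_apply, hp]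
  have e1 : a / √2 + Real.sin θ₁ * α / √2 = (√2)⁻¹ * a + u := by rw [hu]; field_simp
  have e2 : (√2)⁻¹ * a + u - √2 * a = -1 * ((√2)⁻¹ * a + u) + 2 * u := by
    field_simp
    rw [hs2]
    ring
  have e3 : √2 * ((√2)⁻¹ * a + u - u) = a := by field_simp; ring
  rw [e1, e2, e3]
  ring

/-- The `θ₂` kernel is a delta function that fixes `a`, which leaves a phase times the translation
by `√2 a`. -/
lemma exists_displacement_of_sin_eq_zero {θ₁ θ₂ : ℝ} (h1 : Real.cos θ₁ ≠ 0)
    (h2 : Real.sin θ₂ = 0) (α β : ℝ) :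
    ∃ T : H →L[ℂ] H, ∀ φ ψ : 𝓢(ℝ, ℂ), ⟪φ.toLp 2, T (ψ.toLp 2)⟫_ℂ =
      integralΔ β θ₂ fun a => integralΔ α θ₁ (ambiguity (overlap φ ψ a) a) := by
  obtain ⟨k, hk⟩ := exists_integralΔ_ambiguity_of_cos_ne_zero h1 α
  set a := Real.cos θ₂ * β with ha
  set p : ℝ → ℝ := fun x => Real.tan θ₁ / 2 * (a - √2 * x) ^ 2 +
    α / Real.cos θ₁ * (a - √2 * x) with hp
  obtain ⟨T, hT⟩ := exists_weighted_affine (continuous_exp_I_mul (p := p) (by fun_prop))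
    (fun x => norm_phase _) one_ne_zero (-(√2 * a))
  refine ⟨k • T, fun φ ψ => ?_⟩
  rw [integralΔ_of_sin_eq_zero h2, hk, smul_apply, inner_smul_right,
    inner_weighted_affine one_ne_zero hT φ (ψ.coeFn_toLp 2 volume)]
  congr 1
  refine integral_congr_ae (Eventually.of_forall fun x => ?_)
  simp only [overlap_apply, one_mul, ← sub_eq_add_neg, hp]
  ring

/-- An operator with the kernel `exp(i (p₁(x) + s x z + p₂(z)))`, `s ≠ 0`. -/
lemma exists_quadratic_kernel {p₁ p₂ : ℝ → ℝ} (h1 : Continuous p₁) (h2 : Continuous p₂) {s : ℝ}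
    (hs : s ≠ 0) : ∃ T : H →L[ℂ] H, ∀ φ ψ : 𝓢(ℝ, ℂ), ⟪φ.toLp 2, T (ψ.toLp 2)⟫_ℂ =
      ∫ x, starRingEnd ℂ (φ x) * ∫ z, exp (I * ((p₁ x + s * x * z + p₂ z : ℝ) : ℂ)) * ψ z := by
  have hpi := Real.pi_pos
  have hr : -s / (2 * Real.pi) ≠ 0 := div_ne_zero (neg_ne_zero.2 hs) (by positivity)
  obtain ⟨T₁, hT₁⟩ := exists_weighted_affine (continuous_exp_I_mul h1)
    (fun x => norm_phase _) hr 0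
  obtain ⟨T₂, hT₂⟩ := exists_weighted_affine (continuous_exp_I_mul h2)
    (fun x => norm_phase _) one_ne_zero 0
  -- Multiply by the phase of `p₂`, apply the unitary Fourier transform, then dilate by `-s / (2π)`
  -- and multiply by the phase of `p₁`.
  refine ⟨T₁ ∘L (Lp.fourierTransformₗᵢ ℝ ℂ).toLinearIsometry.toContinuousLinearMap ∘L T₂,
    fun φ ψ => ?_⟩
  set f : ℝ → ℂ := fun z => exp (I * (p₂ z : ℂ)) * ψ z with hf
  have hf1 : Integrable f := integrable_exp_mul ψ.integrable h2.measurable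
  have hf2 : MemLp f 2 := (ψ.memLp 2 volume).congr_norm hf1.1 (Eventually.of_forall fun z => by
    rw [hf, norm_mul, norm_phase, one_mul])
  have hT₂f : T₂ (ψ.toLp 2) = hf2.toLp f := by
    refine Lp.ext ((hT₂ _).trans ?_)
    filter_upwards [hf2.coeFn_toLp, ψ.coeFn_toLp 2 volume] with z hz1 hz2
    rw [hz1, one_mul, add_zero, hz2]
  have hc : (T₁ ∘L (Lp.fourierTransformₗᵢ ℝ ℂ).toLinearIsometry.toContinuousLinearMap ∘L T₂)
      (ψ.toLp 2) = T₁ (𝓕 (hf2.toLp f)) := by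
    rw [← hT₂f]
    rfl
  rw [hc, inner_weighted_affine hr hT₁ φ (coeFn_fourier_toLp hf1 hf2)]
  refine integral_congr_ae (Eventually.of_forall fun x => ?_)
  have e : -s / (2 * Real.pi) * x + 0 = -(s * x) / (2 * Real.pi) := by ring
  simp only [e]
  rw [← integral_exp_mul_eq_fourier, ← integral_const_mul]
  congr 1
  refine integral_congr_ae (Eventually.of_forall fun z => ?_)
  simp only [hf, ← mul_assoc, ← Complex.exp_add]
  congr 2
  push_cast
  ring

/-- Substituting `z = x - √2 a` gives `a = (x - z) / √2` and `a - √2 x = -(x + z) / √2`, so the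
total phase is quadratic in `x`, `z` with cross coefficient `(tan θ₁ + cot θ₂) / 2`, nonzero exactly
because `cos(θ₁ - θ₂) ≠ 0`. -/
lemma exists_displacement_of_generic {θ₁ θ₂ : ℝ} (h1 : Real.cos θ₁ ≠ 0)
    (h2 : Real.sin θ₂ ≠ 0) (h : Real.cos (θ₁ - θ₂) ≠ 0) (α β : ℝ) :
    ∃ T : H →L[ℂ] H, ∀ φ ψ : 𝓢(ℝ, ℂ), ⟪φ.toLp 2, T (ψ.toLp 2)⟫_ℂ =
      integralΔ β θ₂ fun a => integralΔ α θ₁ (ambiguity (overlap φ ψ a) a) := by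
  obtain ⟨k, hk⟩ := exists_integralΔ_ambiguity_of_cos_ne_zero h1 α
  have hs0 : √2 ≠ 0 := by positivity
  have hs2 : √2 ^ 2 = 2 := Real.sq_sqrt (by norm_num)
  set t := Real.tan θ₁ with ht
  set c := Real.cot θ₂ with hc
  have hs : (t + c) / 2 ≠ 0 := by
    have : (t + c) / 2 = Real.cos (θ₁ - θ₂) / (2 * Real.cos θ₁ * Real.sin θ₂) := by
      rw [ht, hc, Real.tan_eq_sin_div_cos, Real.cot_eq_cos_div_sin, Real.cos_sub]
      field_simp
      ring
    rw [this]
    positivity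
  obtain ⟨T, hT⟩ := exists_quadratic_kernel
    (p₁ := fun x => -(β ^ 2 * c / 2) + (t - c) / 4 * x ^ 2 +
      (β / Real.sin θ₂ - α / Real.cos θ₁) / √2 * x)
    (p₂ := fun z => (t - c) / 4 * z ^ 2 - (β / Real.sin θ₂ + α / Real.cos θ₁) / √2 * z)
    (by fun_prop) (by fun_prop) hs
  refine ⟨(k * coeffΔ θ₂ * (|(-√2)⁻¹| : ℝ)) • T, fun φ ψ => ?_⟩
  simp only [hk, integralΔ_const_mul]
  rw [smul_apply, inner_smul_right, hT, integralΔ_of_sin_ne_zero h2, mul_assoc, mul_assoc]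
  congr 1
  let F : ℝ → ℝ → ℂ := fun a x => exp (I * ((-((β ^ 2 + a ^ 2) * c / 2) + β * a / Real.sin θ₂ +
    (t / 2 * (a - √2 * x) ^ 2 + α / Real.cos θ₁ * (a - √2 * x)) : ℝ) : ℂ)) * overlap φ ψ a x
  have hF : Integrable (Function.uncurry F) (volume.prod volume) :=
    integrable_exp_mul (integrable_overlap φ ψ) (g := fun q : ℝ × ℝ =>
      -((β ^ 2 + q.1 ^ 2) * c / 2) + β * q.1 / Real.sin θ₂ +
      (t / 2 * (q.1 - √2 * q.2) ^ 2 + α / Real.cos θ₁ * (q.1 - √2 * q.2))) (by fun_prop)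
  trans coeffΔ θ₂ * ∫ a, ∫ x, F a x
  · rw [integral_integral_swap hF, ← integral_const_mul]
    congr 1
    refine integral_congr_ae (Eventually.of_forall fun x => ?_)
    simp only
    rw [mul_left_comm, ← integral_comp_affine _ _ x, ← integral_const_mul]
    refine integral_congr_ae (Eventually.of_forall fun a => ?_)
    simp only [F, overlap_apply]
    have e1 : x - √2 * a = -√2 * a + x := by ring
    rw [e1, mul_left_comm]
    congr 4
    field_simp
    have e4 : √2 ^ 3 = 2 * √2 := by rw [pow_succ, hs2]
    ring_nf
    simp only [e4, hs2]
    ring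
  · rw [← integral_const_mul]
    refine integral_congr_ae (Eventually.of_forall fun a => ?_)
    simp only [F, Δ_eq, mul_assoc, ← integral_const_mul]
    refine integral_congr_ae (Eventually.of_forall fun x => ?_)
    simp only [← mul_assoc]
    congr 1
    rw [mul_assoc, ← Complex.exp_add, ← mul_add, ← ofReal_add]

theorem exists_isBifractionalDisplacement {θ₁ θ₂ : ℝ} (h : Real.cos (θ₁ - θ₂) ≠ 0) (α β : ℝ) :
    ∃ T : H →L[ℂ] H, IsBifractionalDisplacement α β θ₁ θ₂ T := by
  have key : ∃ T : H →L[ℂ] H, ∀ φ ψ : 𝓢(ℝ, ℂ), ⟪φ.toLp 2, T (ψ.toLp 2)⟫_ℂ =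
      integralΔ β θ₂ fun a => integralΔ α θ₁ (ambiguity (overlap φ ψ a) a) := by
    by_cases h1 : Real.cos θ₁ = 0
    · refine exists_displacement_of_cos_eq_zero h1 (fun h2 => h ?_) α β
      rw [Real.cos_sub, h1, h2, zero_mul, mul_zero, add_zero]
    · by_cases h2 : Real.sin θ₂ = 0
      · exact exists_displacement_of_sin_eq_zero h1 h2 α β
      · exact exists_displacement_of_generic h1 h2 h α β
  obtain ⟨T, hT⟩ := key
  refine ⟨((|Real.cos (θ₁ - θ₂)| ^ (1 / 2 : ℝ) : ℝ) : ℂ) • T, fun φ ψ => ?_⟩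
  simp only [inner_D_eq]
  rw [smul_apply, inner_smul_right, hT]

theorem isBifractionalDisplacement_U {θ₁ θ₂ : ℝ} (h : Real.cos (θ₁ - θ₂) ≠ 0) (α β : ℝ) :
    IsBifractionalDisplacement α β θ₁ θ₂ (U α β θ₁ θ₂) := by
  have hex := exists_isBifractionalDisplacement h α β
  rw [U, dif_pos hex]
  exact hex.choose_spec

/-! ### The `L²` norm of the matrix elements between Schwartz functions -/

lemma stronglyMeasurable_integralΔ {X : Type*} [MeasurableSpace X] {f : X → ℝ → ℂ}
    (hf : StronglyMeasurable (Function.uncurry f)) (θ : ℝ) :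
    StronglyMeasurable fun p : X × ℝ => integralΔ p.2 θ (f p.1) := by
  by_cases h : Real.sin θ = 0
  · simp only [integralΔ_of_sin_eq_zero h]
    exact hf.comp_measurable (g := fun p : X × ℝ => (p.1, Real.cos θ * p.2)) (by fun_prop)
  · simp only [integralΔ_of_sin_ne_zero h]
    refine StronglyMeasurable.integral_prod_right
      (f := fun (p : X × ℝ) (y : ℝ) => Δ p.2 y θ * f p.1 y) ?_
    refine StronglyMeasurable.mul ?_
      (hf.comp_measurable (g := fun p : (X × ℝ) × ℝ => (p.1.1, p.2)) (by fun_prop))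
    simp only [Δ_eq]
    exact (by fun_prop : Measurable fun p : (X × ℝ) × ℝ => coeffΔ θ * exp (I *
      ((-((p.1.2 ^ 2 + p.2 ^ 2) * Real.cot θ / 2) + p.1.2 * p.2 / Real.sin θ : ℝ) :
        ℂ))).stronglyMeasurable

lemma stronglyMeasurable_ambiguity (φ ψ : 𝓢(ℝ, ℂ)) :
    StronglyMeasurable (Function.uncurry fun a y : ℝ => ambiguity (overlap φ ψ a) a y) := by
  have hφ := φ.continuous
  have hψ := ψ.continuous
  refine StronglyMeasurable.integral_prod_right (f := fun (p : ℝ × ℝ) (x : ℝ) =>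
    exp (I * ((p.2 * (p.1 - √2 * x) : ℝ) : ℂ)) * overlap φ ψ p.1 x) ?_
  refine Continuous.stronglyMeasurable ?_
  simp only [overlap_apply, Function.uncurry_def]
  fun_prop

lemma stronglyMeasurable_integralΔ_ambiguity (φ ψ : 𝓢(ℝ, ℂ)) (θ : ℝ) :
    StronglyMeasurable (Function.uncurry fun α a : ℝ =>
      integralΔ α θ (ambiguity (overlap φ ψ a) a)) := by
  simp only [Function.uncurry_def]
  exact (stronglyMeasurable_integralΔ (f := fun a => ambiguity (overlap φ ψ a) a)
    (stronglyMeasurable_ambiguity φ ψ) θ).comp_measurable (g := Prod.swap) measurable_swap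

lemma integrable_and_memLp_two_of_bound {f : ℝ → ℂ} (hf : AEStronglyMeasurable f)
    {g : ℝ → ℝ} (hg : Integrable g) {M : ℝ} (h1 : ∀ x, ‖f x‖ ≤ g x) (h2 : ∀ x, ‖f x‖ ≤ M) :
    Integrable f ∧ MemLp f 2 := by
  refine ⟨hg.mono' hf (Eventually.of_forall h1), (memLp_two_iff_integrable_sq_norm hf).2 ?_⟩
  refine (hg.const_mul M).mono' (hf.norm.pow 2) (Eventually.of_forall fun x => ?_)
  rw [Real.norm_of_nonneg (by positivity), sq]
  exact mul_le_mul (h2 x) (h1 x) (norm_nonneg _) ((norm_nonneg _).trans (h2 x))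

lemma norm_schwartz_le (ψ : 𝓢(ℝ, ℂ)) : ∃ M : ℝ, 0 ≤ M ∧ ∀ x, ‖ψ x‖ ≤ M :=
  ⟨SchwartzMap.seminorm ℂ 0 0 ψ, apply_nonneg _ _, SchwartzMap.norm_le_seminorm ℂ ψ⟩

/-- Needed to apply Plancherel a second time, in `a`. The closed forms bound the function by a
multiple of a rescaled `|φ|` or of `∫ |overlap φ ψ a|`, both integrable and bounded in `a`. -/
lemma integrable_and_memLp_integralΔ_ambiguity (φ ψ : 𝓢(ℝ, ℂ)) (α θ : ℝ) :
    Integrable (fun a => integralΔ α θ (ambiguity (overlap φ ψ a) a)) ∧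
      MemLp (fun a => integralΔ α θ (ambiguity (overlap φ ψ a) a)) 2 := by
  obtain ⟨M, hM0, hM⟩ := norm_schwartz_le ψ
  obtain ⟨N, hN0, hN⟩ := norm_schwartz_le φ
  have hmeas : AEStronglyMeasurable (fun a => integralΔ α θ (ambiguity (overlap φ ψ a) a)) :=
    ((stronglyMeasurable_integralΔ_ambiguity φ ψ θ).comp_measurable
      (g := fun a : ℝ => (α, a)) (by fun_prop)).aestronglyMeasurable
  by_cases h : Real.cos θ = 0
  · have hi : Integrable fun a : ℝ => φ ((√2)⁻¹ * a + Real.sin θ * α / √2) :=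
      (φ.integrable.comp_add_right (Real.sin θ * α / √2)).comp_mul_left' (by positivity)
    have hb : ∀ a, ‖integralΔ α θ (ambiguity (overlap φ ψ a) a)‖ ≤
        ‖coeffΔ θ * (√2 * Real.pi : ℝ)‖ * M * ‖φ ((√2)⁻¹ * a + Real.sin θ * α / √2)‖ := by
      intro a
      rw [integralΔ_ambiguity_of_cos_eq_zero h, norm_mul, overlap_apply,
        norm_mul (starRingEnd ℂ _), RCLike.norm_conj, div_eq_inv_mul a, mul_assoc _ M, mul_comm M]
      gcongr
      exact hM _
    exact integrable_and_memLp_two_of_bound hmeas (hi.norm.const_mul _) hb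
      fun a => (hb a).trans (mul_le_mul_of_nonneg_left (hN _) (by positivity))
  · obtain ⟨k, hk⟩ := exists_integralΔ_ambiguity_of_cos_ne_zero h α
    have hb : ∀ a, ‖integralΔ α θ (ambiguity (overlap φ ψ a) a)‖ ≤
        ‖k‖ * ∫ x, ‖overlap φ ψ a x‖ := by
      intro a
      rw [hk, norm_mul]
      gcongr
      refine (norm_integral_le_integral_norm _).trans (le_of_eq ?_)
      simp only [norm_mul, norm_phase, one_mul]
    have hi : Integrable fun a : ℝ => ∫ x, ‖overlap φ ψ a x‖ :=
      (integrable_overlap φ ψ).integral_norm_prod_left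
    refine integrable_and_memLp_two_of_bound hmeas (hi.const_mul _) hb
      (M := ‖k‖ * (M * ∫ x, ‖φ x‖)) fun a => (hb a).trans ?_
    gcongr
    rw [← integral_const_mul]
    refine integral_mono (overlap φ ψ a).integrable.norm (φ.integrable.norm.const_mul _)
      fun x => ?_
    simp only [overlap_apply, norm_mul, RCLike.norm_conj]
    rw [mul_comm M]
    gcongr
    exact hM _

lemma lintegral_overlap_sq (φ ψ : 𝓢(ℝ, ℂ)) :
    ∫⁻ a, ∫⁻ x, ‖overlap φ ψ a x‖ₑ ^ 2 =
      ENNReal.ofReal (√2)⁻¹ * ((∫⁻ x, ‖φ x‖ₑ ^ 2) * ∫⁻ x, ‖ψ x‖ₑ ^ 2) := by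
  have hφ := φ.continuous
  have hψ := ψ.continuous
  have hcont : Continuous (Function.uncurry fun a x : ℝ => ‖overlap φ ψ a x‖ₑ ^ 2) := by
    simp only [Function.uncurry_def, overlap_apply]
    fun_prop
  rw [lintegral_lintegral_swap hcont.aemeasurable]
  have hfin : ∫⁻ x, ‖ψ x‖ₑ ^ 2 ≠ ⊤ := by
    have := (ψ.memLp 2 (volume : Measure ℝ)).2
    rw [← eLpNorm_two_sq]
    finiteness
  have h : ∀ x : ℝ, ∫⁻ a, ‖overlap φ ψ a x‖ₑ ^ 2 =
      ‖φ x‖ₑ ^ 2 * (ENNReal.ofReal (√2)⁻¹ * ∫⁻ x, ‖ψ x‖ₑ ^ 2) := fun x => by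
    have hx : ∀ a, ‖overlap φ ψ a x‖ₑ ^ 2 = ‖φ x‖ₑ ^ 2 * ‖ψ (-√2 * a + x)‖ₑ ^ 2 := fun a => by
      rw [overlap_apply, enorm_mul, mul_pow, RCLike.enorm_conj]
      congr 5
      ring
    simp only [hx]
    rw [lintegral_const_mul' _ _ (by finiteness),
      lintegral_comp_affine (fun x => ‖ψ x‖ₑ ^ 2) (neg_ne_zero.2 (by positivity)), abs_inv,
      abs_neg, abs_of_pos (by positivity)]
  simp only [h]
  rw [lintegral_mul_const' _ _ (by finiteness)]
  ring

lemma inner_U_schwartz {θ₁ θ₂ : ℝ} (h : Real.cos (θ₁ - θ₂) ≠ 0) (φ ψ : 𝓢(ℝ, ℂ)) (p : ℝ × ℝ) :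
    ⟪φ.toLp 2, U p.1 p.2 θ₁ θ₂ (ψ.toLp 2)⟫_ℂ =
      ((|Real.cos (θ₁ - θ₂)| ^ (1 / 2 : ℝ) : ℝ) : ℂ) * integralΔ p.2 θ₂ fun a =>
        integralΔ p.1 θ₁ (ambiguity (overlap φ ψ a) a) := by
  rw [isBifractionalDisplacement_U h]
  simp only [inner_D_eq]

lemma stronglyMeasurable_inner_U_schwartz {θ₁ θ₂ : ℝ} (h : Real.cos (θ₁ - θ₂) ≠ 0)
    (φ ψ : 𝓢(ℝ, ℂ)) :
    StronglyMeasurable fun p : ℝ × ℝ => ⟪φ.toLp 2, U p.1 p.2 θ₁ θ₂ (ψ.toLp 2)⟫_ℂ := by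
  simp only [inner_U_schwartz h]
  exact (stronglyMeasurable_integralΔ
    (f := fun α a => integralΔ α θ₁ (ambiguity (overlap φ ψ a) a))
    (stronglyMeasurable_integralΔ_ambiguity φ ψ θ₁) θ₂).const_mul _

lemma lintegral_lintegral_enorm_sq_swap {G : ℝ → ℝ → ℂ}
    (hG : StronglyMeasurable (Function.uncurry G)) :
    ∫⁻ x, ∫⁻ y, ‖G x y‖ₑ ^ 2 = ∫⁻ y, ∫⁻ x, ‖G x y‖ₑ ^ 2 :=
  lintegral_lintegral_swap (f := fun x y : ℝ => ‖G x y‖ₑ ^ 2)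
    (hG.enorm.pow_const 2).aemeasurable

/-- Plancherel in `β` at fixed `α`, Tonelli, then Plancherel in `α` at fixed `a`. -/
lemma lintegral_enorm_integralΔ_integralΔ_sq (θ₁ θ₂ : ℝ) {F : ℝ → ℝ → ℂ}
    (hm : StronglyMeasurable (Function.uncurry fun α a : ℝ => integralΔ α θ₁ (F a)))
    (h₁ : ∀ a, Integrable (F a) ∧ MemLp (F a) 2)
    (h₂ : ∀ α, Integrable (fun a => integralΔ α θ₁ (F a)) ∧
      MemLp (fun a => integralΔ α θ₁ (F a)) 2) :
    ∫⁻ p : ℝ × ℝ, ‖integralΔ p.2 θ₂ fun a => integralΔ p.1 θ₁ (F a)‖ₑ ^ 2 =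
      ∫⁻ a, ∫⁻ y, ‖F a y‖ₑ ^ 2 := by
  have hW : Measurable fun p : ℝ × ℝ => ‖integralΔ p.2 θ₂ fun a => integralΔ p.1 θ₁ (F a)‖ₑ ^ 2 :=
    (stronglyMeasurable_integralΔ (f := fun α a => integralΔ α θ₁ (F a)) hm θ₂).enorm.pow_const 2
  have hs := lintegral_lintegral_enorm_sq_swap hm
  have e₂ : ∀ α, ∫⁻ β, ‖integralΔ β θ₂ fun a => integralΔ α θ₁ (F a)‖ₑ ^ 2 =
      ∫⁻ a, ‖integralΔ α θ₁ (F a)‖ₑ ^ 2 := fun α =>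
    lintegral_enorm_integralΔ_sq θ₂ (f := fun a => integralΔ α θ₁ (F a)) (h₂ α).1 (h₂ α).2
  have e₁ : ∀ a, ∫⁻ α, ‖integralΔ α θ₁ (F a)‖ₑ ^ 2 = ∫⁻ y, ‖F a y‖ₑ ^ 2 := fun a =>
    lintegral_enorm_integralΔ_sq θ₁ (f := F a) (h₁ a).1 (h₁ a).2
  rw [Measure.volume_eq_prod, lintegral_prod _ hW.aemeasurable]
  simp only [e₂, hs, e₁]

/-- The constant is `|cos(θ₁ - θ₂)|` from the prefactor, `√2 π` from the ambiguity function and `1 /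
√2` from the overlap. -/
lemma lintegral_inner_U_schwartz_sq {θ₁ θ₂ : ℝ} (h : Real.cos (θ₁ - θ₂) ≠ 0)
    (φ ψ : 𝓢(ℝ, ℂ)) :
    ∫⁻ p : ℝ × ℝ, ‖⟪φ.toLp 2, U p.1 p.2 θ₁ θ₂ (ψ.toLp 2)⟫_ℂ‖ₑ ^ 2 =
      ENNReal.ofReal (Real.pi * |Real.cos (θ₁ - θ₂)|) *
        (‖φ.toLp 2 (volume : Measure ℝ)‖ₑ ^ 2 * ‖ψ.toLp 2 (volume : Measure ℝ)‖ₑ ^ 2) := by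
  have hpi := Real.pi_pos
  have hc : ‖((|Real.cos (θ₁ - θ₂)| ^ (1 / 2 : ℝ) : ℝ) : ℂ)‖ₑ ^ 2 =
      ENNReal.ofReal |Real.cos (θ₁ - θ₂)| := by
    rw [← ofReal_norm, ← ENNReal.ofReal_pow (norm_nonneg _), Complex.norm_real,
      Real.norm_of_nonneg (by positivity), ← Real.rpow_natCast, ← Real.rpow_mul (abs_nonneg _)]
    norm_num
  have hF := lintegral_enorm_integralΔ_integralΔ_sq θ₁ θ₂
    (F := fun a => ambiguity (overlap φ ψ a) a) (stronglyMeasurable_integralΔ_ambiguity φ ψ θ₁)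
    (fun a => ⟨integrable_ambiguity _ _, memLp_ambiguity _ _⟩)
    (fun α => integrable_and_memLp_integralΔ_ambiguity φ ψ α θ₁)
  simp only [inner_U_schwartz h, enorm_mul, mul_pow, hc]
  rw [lintegral_const_mul' _ _ (by finiteness), hF]
  simp only [lintegral_enorm_ambiguity_sq]
  rw [lintegral_const_mul' _ _ (by finiteness), lintegral_overlap_sq, Lp.enorm_def, Lp.enorm_def,
    eLpNorm_congr_ae (φ.coeFn_toLp 2 volume), eLpNorm_congr_ae (ψ.coeFn_toLp 2 volume),
    eLpNorm_two_sq, eLpNorm_two_sq]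
  simp only [← mul_assoc]
  congr 2
  rw [← ENNReal.ofReal_mul (by positivity), ← ENNReal.ofReal_mul (by positivity)]
  congr 1
  field_simp

/-! ### Families of operators with square integrable matrix elements -/

lemma exists_seq_tendsto_of_denseRange {E : Type*} [SeminormedAddCommGroup E] {S : Type*} {ι : S → E} (hι : DenseRange ι) (u : E) :
    ∃ s : ℕ → S, Tendsto (fun n => ι (s n)) atTop (𝓝 u) := by
  obtain ⟨x, hx, hxu⟩ := mem_closure_iff_seq_limit.1 (hι u)
  choose s hs using hx
  exact ⟨s, by simpa only [hs] using hxu⟩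

section SquareIntegrable

variable {E : Type*} [NormedAddCommGroup E] [InnerProductSpace ℂ E]
  {X : Type*} [MeasurableSpace X] {μ : Measure X}

/-- Polarization: the diagonal at `x + y` and `x + i y` gives two linear equations for `S x y` and
`S y x`. -/
lemma sesquilinear_eq_of_diagonal {S : E → E → ℂ} {K : ℂ}
    (hadd₁ : ∀ x y z, S (x + y) z = S x z + S y z) (hadd₂ : ∀ x y z, S x (y + z) = S x y + S x z)
    (hI₁ : ∀ x y, S (I • x) y = -I * S x y) (hI₂ : ∀ x y, S x (I • y) = I * S x y)
    (h : ∀ x, S x x = K * ⟪x, x⟫_ℂ) (x y : E) : S x y = K * ⟪x, y⟫_ℂ := by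
  have e₁ := h (x + y)
  have e₂ := h (x + I • y)
  simp only [hadd₁, hadd₂, hI₁, hI₂, inner_add_left, inner_add_right, inner_smul_left,
    inner_smul_right, h x, h y, conj_I] at e₁ e₂
  linear_combination (1 / 2) * e₁ - (I / 2) * e₂ +
    (S x y - S y x - K * ⟪x, y⟫_ℂ + K * ⟪y, x⟫_ℂ) / 2 * I_sq

variable {S : Type*} {ι : S → E} {W : X → E →L[ℂ] E} {C : ℝ}

lemma aestronglyMeasurable_inner_of_denseRange (hι : DenseRange ι)
    (hm : ∀ s t, AEStronglyMeasurable (fun p => ⟪ι s, W p (ι t)⟫_ℂ) μ) (v u : E) :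
    AEStronglyMeasurable (fun p => ⟪v, W p u⟫_ℂ) μ := by
  obtain ⟨s, hs⟩ := exists_seq_tendsto_of_denseRange hι v
  obtain ⟨t, ht⟩ := exists_seq_tendsto_of_denseRange hι u
  exact aestronglyMeasurable_of_tendsto_ae atTop (fun n => hm (s n) (t n))
    (Eventually.of_forall fun p => hs.inner (((W p).continuous.tendsto u).comp ht))

/-- Fatou's lemma gives only an inequality, but this suffices to make the matrix elements a bounded
sesquilinear map into `L²`. -/
lemma lintegral_inner_sq_le_of_denseRange (hι : DenseRange ι)
    (hm : ∀ s t, AEStronglyMeasurable (fun p => ⟪ι s, W p (ι t)⟫_ℂ) μ)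
    (hn : ∀ s t, ∫⁻ p, ‖⟪ι s, W p (ι t)⟫_ℂ‖ₑ ^ 2 ∂μ =
      ENNReal.ofReal C * (‖ι s‖ₑ ^ 2 * ‖ι t‖ₑ ^ 2)) (v u : E) :
    ∫⁻ p, ‖⟪v, W p u⟫_ℂ‖ₑ ^ 2 ∂μ ≤ ENNReal.ofReal C * (‖v‖ₑ ^ 2 * ‖u‖ₑ ^ 2) := by
  obtain ⟨s, hs⟩ := exists_seq_tendsto_of_denseRange hι v
  obtain ⟨t, ht⟩ := exists_seq_tendsto_of_denseRange hι u
  have hlim : ∀ p, Tendsto (fun n => ‖⟪ι (s n), W p (ι (t n))⟫_ℂ‖ₑ ^ 2) atTop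
      (𝓝 (‖⟪v, W p u⟫_ℂ‖ₑ ^ 2)) := fun p =>
    ENNReal.Tendsto.pow (hs.inner (((W p).continuous.tendsto u).comp ht)).enorm
  have hlim' : Tendsto (fun n => ENNReal.ofReal C * (‖ι (s n)‖ₑ ^ 2 * ‖ι (t n)‖ₑ ^ 2)) atTop
      (𝓝 (ENNReal.ofReal C * (‖v‖ₑ ^ 2 * ‖u‖ₑ ^ 2))) := by
    refine ENNReal.Tendsto.const_mul ?_ (Or.inr ENNReal.ofReal_ne_top)
    exact ENNReal.Tendsto.mul (ENNReal.Tendsto.pow hs.enorm) (Or.inr (by finiteness))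
      (ENNReal.Tendsto.pow ht.enorm) (Or.inr (by finiteness))
  calc ∫⁻ p, ‖⟪v, W p u⟫_ℂ‖ₑ ^ 2 ∂μ
      = ∫⁻ p, liminf (fun n => ‖⟪ι (s n), W p (ι (t n))⟫_ℂ‖ₑ ^ 2) atTop ∂μ :=
        lintegral_congr fun p => (hlim p).liminf_eq.symm
    _ ≤ liminf (fun n => ∫⁻ p, ‖⟪ι (s n), W p (ι (t n))⟫_ℂ‖ₑ ^ 2 ∂μ) atTop :=
        lintegral_liminf_le' fun n => (hm (s n) (t n)).enorm.pow_const 2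
    _ = _ := by
        simp only [hn]
        exact hlim'.liminf_eq

/-- If the orthogonality relations hold for the matrix elements of `W` on a dense set, then the
matrix elements of `W` are square integrable, and the orthogonality relations hold for all of
them. -/
theorem exists_sesquilinear_of_denseRange (hι : DenseRange ι) (hC : 0 ≤ C)
    (hm : ∀ s t, AEStronglyMeasurable (fun p => ⟪ι s, W p (ι t)⟫_ℂ) μ)
    (hn : ∀ s t, ∫⁻ p, ‖⟪ι s, W p (ι t)⟫_ℂ‖ₑ ^ 2 ∂μ =
      ENNReal.ofReal C * (‖ι s‖ₑ ^ 2 * ‖ι t‖ₑ ^ 2)) :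
    ∃ B : E →L⋆[ℂ] E →L[ℂ] Lp ℂ 2 μ, (∀ v u, B v u =ᵐ[μ] fun p => ⟪v, W p u⟫_ℂ) ∧
      ∀ a b c d, ⟪B a b, B c d⟫_ℂ = C * ⟪c, a⟫_ℂ * ⟪b, d⟫_ℂ := by
  have hle := lintegral_inner_sq_le_of_denseRange hι hm hn
  have hmem : ∀ v u, MemLp (fun p => ⟪v, W p u⟫_ℂ) 2 μ := fun v u => by
    refine ⟨aestronglyMeasurable_inner_of_denseRange hι hm v u, ?_⟩
    have h : eLpNorm (fun p => ⟪v, W p u⟫_ℂ) 2 μ ^ 2 < ⊤ := by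
      rw [eLpNorm_two_sq]
      exact (hle v u).trans_lt (by finiteness)
    simpa using h
  have hsq : ∀ v u, ‖(hmem v u).toLp‖ₑ ^ 2 = ∫⁻ p, ‖⟪v, W p u⟫_ℂ‖ₑ ^ 2 ∂μ := fun v u => by
    rw [Lp.enorm_def, eLpNorm_congr_ae (hmem v u).coeFn_toLp, eLpNorm_two_sq]
  have hbound : ∀ v u, ‖(hmem v u).toLp‖ ≤ √C * ‖v‖ * ‖u‖ := fun v u => by
    have h := hle v u
    rw [← hsq, ← ofReal_norm, ← ofReal_norm, ← ofReal_norm, ← ENNReal.ofReal_pow (norm_nonneg _),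
      ← ENNReal.ofReal_pow (norm_nonneg _), ← ENNReal.ofReal_pow (norm_nonneg _),
      ← ENNReal.ofReal_mul (by positivity), ← ENNReal.ofReal_mul hC,
      ENNReal.ofReal_le_ofReal_iff (by positivity)] at h
    refine (sq_le_sq₀ (norm_nonneg _) (by positivity)).1 ?_
    rw [mul_pow, mul_pow, Real.sq_sqrt hC]
    linarith
  let B₀ : E →ₗ⋆[ℂ] E →ₗ[ℂ] Lp ℂ 2 μ :=
    LinearMap.mk₂'ₛₗ (starRingEnd ℂ) (RingHom.id ℂ) (fun v u => (hmem v u).toLp)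
      (fun v w u => by
        rw [← MemLp.toLp_add]
        congr 1
        ext p
        exact inner_add_left _ _ _)
      (fun c v u => by
        rw [← MemLp.toLp_const_smul]
        congr 1
        ext p
        exact inner_smul_left _ _ _)
      (fun v u w => by
        rw [← MemLp.toLp_add]
        congr 1
        ext p
        simp)
      (fun c v u => by
        rw [← MemLp.toLp_const_smul]
        congr 1
        ext p
        simp)
  let B : E →L⋆[ℂ] E →L[ℂ] Lp ℂ 2 μ := B₀.mkContinuous₂ (√C) hbound
  have hB : ∀ v u, B v u = (hmem v u).toLp := fun v u => rfl
  -- Equality is recovered because both sides are continuous and agree on a dense set.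
  have hnorm : ∀ v u, ‖B v u‖ ^ 2 = C * (‖v‖ ^ 2 * ‖u‖ ^ 2) := by
    have h : (fun q : E × E => ‖B q.1 q.2‖ ^ 2) = fun q => C * (‖q.1‖ ^ 2 * ‖q.2‖ ^ 2) := by
      refine (hι.prodMap hι).equalizer (by fun_prop) (by fun_prop) (funext fun q => ?_)
      have h := congrArg ENNReal.toReal ((hsq (ι q.1) (ι q.2)).trans (hn q.1 q.2))
      simpa [ENNReal.toReal_ofReal hC, hB] using h
    exact fun v u => congrFun h (v, u)
  refine ⟨B, fun v u => (hmem v u).coeFn_toLp, fun a b c d => ?_⟩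
  -- Polarization in the second arguments; `h2` then polarizes the first ones. As `B` is conjugate
  -- linear there, the form is linear in `a` and conjugate linear in `c`, hence the order `c`, `a`.
  have h1 : ∀ a b d, ⟪B a b, B a d⟫_ℂ = (C * ⟪a, a⟫_ℂ) * ⟪b, d⟫_ℂ := fun a =>
    sesquilinear_eq_of_diagonal (S := fun b d => ⟪B a b, B a d⟫_ℂ)
      (fun x y z => by simp only [map_add, inner_add_left])
      (fun x y z => by simp only [map_add, inner_add_right])
      (fun x y => by simp only [map_smul, inner_smul_left, conj_I])
      (fun x y => by simp only [map_smul, inner_smul_right])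
      (fun x => by
        rw [inner_self_eq_norm_sq_to_K, inner_self_eq_norm_sq_to_K, inner_self_eq_norm_sq_to_K]
        have := hnorm a x
        simp only [coe_algebraMap]
        rw [mul_assoc]
        exact_mod_cast this)
  have h2 := sesquilinear_eq_of_diagonal (S := fun c a => ⟪B a b, B c d⟫_ℂ) (K := C * ⟪b, d⟫_ℂ)
    (fun x y z => by simp only [map_add, add_apply, inner_add_right])
    (fun x y z => by simp only [map_add, add_apply, inner_add_left])
    (fun x y => by simp [inner_smul_right])
    (fun x y => by simp [inner_smul_left])
    (fun x => by rw [h1]; ring) c a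
  rw [h2]
  ring

/-- A series that converges in `L²` and pointwise has the same sum in both senses. -/
lemma coeFn_eq_of_hasSum {f : ℕ → Lp ℂ 2 μ} {G : Lp ℂ 2 μ} (hf : HasSum f G) {F : ℕ → X → ℂ}
    (hF : ∀ n, f n =ᵐ[μ] F n) {s : X → ℂ} (hs : ∀ x, HasSum (fun n => F n x) (s x)) :
    G =ᵐ[μ] s := by
  obtain ⟨ns, hns, hlim⟩ :=
    (tendstoInMeasure_of_tendsto_Lp hf.tendsto_sum_nat).exists_seq_tendsto_ae
  have hsum : ∀ᵐ x ∂μ, ∀ n, (∑ i ∈ Finset.range n, f i : Lp ℂ 2 μ) x =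
      ∑ i ∈ Finset.range n, F i x := by
    refine ae_all_iff.2 fun n => ?_
    filter_upwards [Lp.coeFn_finsetSum (Finset.range n) f, ae_all_iff.2 hF] with x h1 h2
    rw [h1, Finset.sum_apply]
    exact Finset.sum_congr rfl fun i _ => h2 i
  filter_upwards [hlim, hsum] with x h1 h2
  simp only [h2] at h1
  exact tendsto_nhds_unique h1 ((hs x).tendsto_sum_nat.comp hns.tendsto_atTop)

end SquareIntegrable

/-! ### Traces -/

/-- `S * T` is nuclear with vectors `S (u n)` and `v n`. With `S` equal to `U` or its adjoint, this
expands `A` and `A†` pointwise in matrix elements of `U`. -/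
lemma hasSum_Tr_mul {T : H →L[ℂ] H} {u v : ℕ → H} (hs : Summable fun n => ‖u n‖ * ‖v n‖)
    (hT : ∀ x : H, HasSum (fun n => ⟪v n, x⟫_ℂ • u n) (T x)) (S : H →L[ℂ] H) :
    HasSum (fun n => ⟪v n, S (u n)⟫_ℂ) (Tr (T * S)) := by
  rw [Tr_mul_comm ⟨u, v, hs, hT⟩]
  have hs' : Summable fun n => ‖S (u n)‖ * ‖v n‖ := by
    refine Summable.of_nonneg_of_le (fun n => by positivity) (fun n => ?_) (hs.mul_left ‖S‖)
    rw [← mul_assoc]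
    gcongr
    exact S.le_opNorm _
  have h := hasSum_inner_of_nuclear basis (T := S * T) hs' fun x => by
    simpa only [map_smul, mul_apply_eq_comp] using (hT x).mapL S
  have hsum : Summable fun n => ⟪v n, S (u n)⟫_ℂ :=
    Summable.of_norm_bounded hs' fun n => by
      rw [mul_comm]
      exact norm_inner_le_norm _ _
  rw [Tr, h.tsum_eq]
  exact hsum.hasSum

lemma summable_sesquilinear {F : Type*} [NormedAddCommGroup F] [NormedSpace ℂ F]
    [CompleteSpace F] (B : H →L⋆[ℂ] H →L[ℂ] F) {u v : ℕ → H}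
    (hs : Summable fun n => ‖u n‖ * ‖v n‖) : Summable fun n => B (v n) (u n) := by
  refine Summable.of_norm_bounded (hs.mul_left ‖B‖) fun n => ?_
  rw [mul_comm ‖u n‖, ← mul_assoc]
  exact B.le_opNorm₂ _ _

/-! ### The reconstruction and trace formulas -/

theorem bifractional_reconstruction {θ₁ θ₂ : ℝ} (hθ : Real.cos (θ₁ - θ₂) ≠ 0) :
    (∀ Θ : H →L[ℂ] H, IsTraceClass Θ → ∀ φ ψ : H,
      Integrable (fun p : ℝ × ℝ => Adag p.1 p.2 θ₁ θ₂ Θ * ⟪φ, U p.1 p.2 θ₁ θ₂ ψ⟫_ℂ) ∧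
      ∫ p : ℝ × ℝ, Adag p.1 p.2 θ₁ θ₂ Θ * ⟪φ, U p.1 p.2 θ₁ θ₂ ψ⟫_ℂ =
        ((Real.pi * |Real.cos (θ₁ - θ₂)| : ℝ) : ℂ) * ⟪φ, Θ ψ⟫_ℂ) ∧
    (∀ Θ₁ Θ₂ : H →L[ℂ] H, IsTraceClass Θ₁ → IsTraceClass Θ₂ →
      Integrable (fun p : ℝ × ℝ => A p.1 p.2 θ₁ θ₂ Θ₁ * Adag p.1 p.2 θ₁ θ₂ Θ₂) ∧
      ∫ p : ℝ × ℝ, A p.1 p.2 θ₁ θ₂ Θ₁ * Adag p.1 p.2 θ₁ θ₂ Θ₂ =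
        ((Real.pi * |Real.cos (θ₁ - θ₂)| : ℝ) : ℂ) * Tr (Θ₁ * Θ₂)) := by
  have hpi := Real.pi_pos
  have hd : DenseRange (fun f : 𝓢(ℝ, ℂ) => (f.toLp 2 : H)) :=
    SchwartzMap.denseRange_toLpCLM (E := ℝ) (F := ℂ) (p := 2) (μ := volume) (by simp)
  set C : ℝ := Real.pi * |Real.cos (θ₁ - θ₂)| with hC
  obtain ⟨B, hB, hBC⟩ := exists_sesquilinear_of_denseRange (μ := (volume : Measure (ℝ × ℝ)))
    (W := fun p => U p.1 p.2 θ₁ θ₂) hd (C := C) (by positivity)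
    (fun s t => (stronglyMeasurable_inner_U_schwartz hθ s t).aestronglyMeasurable)
    (fun s t => lintegral_inner_U_schwartz_sq hθ s t)
  -- `A†` is the complex conjugate of an element `G` of `L²(ℝ²)`
  have hdag : ∀ Θ : H →L[ℂ] H, IsTraceClass Θ → ∃ G : Lp ℂ 2 (volume : Measure (ℝ × ℝ)),
      ((fun p : ℝ × ℝ => starRingEnd ℂ (G p)) =ᵐ[volume] fun p => Adag p.1 p.2 θ₁ θ₂ Θ) ∧
      ∀ a b, ⟪G, B a b⟫_ℂ = C * ⟪a, Θ b⟫_ℂ := by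
    rintro Θ ⟨u, v, hs, hT⟩
    have hs' : Summable fun n => ‖v n‖ * ‖u n‖ := by simpa only [mul_comm] using hs
    have hG := (summable_sesquilinear B hs').hasSum
    -- The conjugate of `⟪v n, U† (u n)⟫` is `⟪u n, U (v n)⟫`. By orthogonality, pairing with `B a
    -- b` gives `C ∑ ⟪a, u n⟫ ⟪v n, b⟫ = C ⟪a, Θ b⟫`.
    refine ⟨∑' n, B (u n) (v n), ?_, fun a b => ?_⟩
    · have h := coeFn_eq_of_hasSum hG (fun n => hB (u n) (v n))
        (s := fun p => starRingEnd ℂ (Adag p.1 p.2 θ₁ θ₂ Θ)) fun p => by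
          have h := (hasSum_Tr_mul hs hT (U p.1 p.2 θ₁ θ₂).adjoint).mapL
            (Complex.conjCLE : ℂ →L[ℝ] ℂ)
          simpa [Adag, ContinuousLinearMap.adjoint_inner_right] using h
      filter_upwards [h] with p hp
      rw [hp, conj_conj]
    · have h1 := hG.mapL ((innerSL ℂ).flip (B a b))
      have h2 := ((hT b).mapL (innerSL ℂ a)).mul_left (C : ℂ)
      refine h1.unique ?_
      simpa [hBC, inner_smul_right, mul_assoc, mul_comm] using h2
  refine ⟨fun Θ hΘ φ ψ => ?_, fun Θ₁ Θ₂ h₁ h₂ => ?_⟩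
  · obtain ⟨G, hG, hGB⟩ := hdag Θ hΘ
    have h : (fun p => ⟪G p, B φ ψ p⟫_ℂ) =ᵐ[volume]
        fun p : ℝ × ℝ => Adag p.1 p.2 θ₁ θ₂ Θ * ⟪φ, U p.1 p.2 θ₁ θ₂ ψ⟫_ℂ := by
      filter_upwards [hG, hB φ ψ] with p h1 h2
      rw [RCLike.inner_apply, h1, h2, mul_comm]
    exact ⟨(L2.integrable_inner G (B φ ψ)).congr h, by
      rw [← integral_congr_ae h, ← L2.inner_def, hGB]⟩
  · obtain ⟨G, hG, hGB⟩ := hdag Θ₂ h₂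
    obtain ⟨u, v, hs, hT⟩ := h₁
    have hsum := (summable_sesquilinear B hs).hasSum
    have hA := coeFn_eq_of_hasSum hsum (fun n => hB (v n) (u n))
      (s := fun p => A p.1 p.2 θ₁ θ₂ Θ₁) fun p => hasSum_Tr_mul hs hT (U p.1 p.2 θ₁ θ₂)
    have h : (fun p => ⟪G p, (∑' n, B (v n) (u n) : Lp ℂ 2 (volume : Measure (ℝ × ℝ))) p⟫_ℂ)
        =ᵐ[volume] fun p : ℝ × ℝ => A p.1 p.2 θ₁ θ₂ Θ₁ * Adag p.1 p.2 θ₁ θ₂ Θ₂ := by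
      filter_upwards [hG, hA] with p h1 h2
      rw [RCLike.inner_apply, h1, h2]
    refine ⟨(L2.integrable_inner G _).congr h, ?_⟩
    rw [← integral_congr_ae h, ← L2.inner_def]
    -- Term by term, the pairing of `G` with the series for `A` is `C ∑ ⟪v n, Θ₂ (u n)⟫`, which is
    -- `C` times the trace of the product.
    refine (hsum.mapL (innerSL ℂ G)).unique ?_
    simpa only [innerSL_apply_apply, hGB] using (hasSum_Tr_mul hs hT Θ₂).mul_left (C : ℂ)

end Bifractional

theorem mainTheorem5 (θ₁ θ₂ : ℝ) (hθ : Real.cos (θ₁ - θ₂) ≠ 0) :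
    -- the integral that defines `U(α, β; θ₁, θ₂)` does define a bounded operator
    (∀ α β : ℝ, IsBifractionalDisplacement α β θ₁ θ₂ (U α β θ₁ θ₂)) ∧
    -- (1) reconstruction of an operator, as a weakly convergent operator integral
    (∀ Θ : H →L[ℂ] H, IsTraceClass Θ → ∀ φ ψ : H,
      Integrable (fun p : ℝ × ℝ => Adag p.1 p.2 θ₁ θ₂ Θ * ⟪φ, U p.1 p.2 θ₁ θ₂ ψ⟫_ℂ) ∧
      ⟪φ, Θ ψ⟫_ℂ = ((1 / (Real.pi * |Real.cos (θ₁ - θ₂)|) : ℝ) : ℂ) *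
        ∫ p : ℝ × ℝ, Adag p.1 p.2 θ₁ θ₂ Θ * ⟪φ, U p.1 p.2 θ₁ θ₂ ψ⟫_ℂ) ∧
    -- (2) trace of a product
    (∀ Θ₁ Θ₂ : H →L[ℂ] H, IsTraceClass Θ₁ → IsTraceClass Θ₂ →
      Integrable (fun p : ℝ × ℝ => A p.1 p.2 θ₁ θ₂ Θ₁ * Adag p.1 p.2 θ₁ θ₂ Θ₂) ∧
      Tr (Θ₁ * Θ₂) = ((1 / (Real.pi * |Real.cos (θ₁ - θ₂)|) : ℝ) : ℂ) *
        ∫ p : ℝ × ℝ, A p.1 p.2 θ₁ θ₂ Θ₁ * Adag p.1 p.2 θ₁ θ₂ Θ₂) := by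
  have hC : Real.pi * |Real.cos (θ₁ - θ₂)| ≠ 0 :=
    mul_ne_zero Real.pi_ne_zero (abs_ne_zero.2 hθ)
  have hinv : ∀ z : ℂ, z = ((1 / (Real.pi * |Real.cos (θ₁ - θ₂)|) : ℝ) : ℂ) *
      (((Real.pi * |Real.cos (θ₁ - θ₂)| : ℝ) : ℂ) * z) := fun z => by
    rw [← mul_assoc, ← Complex.ofReal_mul, one_div_mul_cancel hC, Complex.ofReal_one, one_mul]
  obtain ⟨h1, h2⟩ := bifractional_reconstruction hθ
  refine ⟨isBifractionalDisplacement_U hθ, fun Θ hΘ φ ψ => ⟨(h1 Θ hΘ φ ψ).1, ?_⟩,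
    fun Θ₁ Θ₂ hΘ₁ hΘ₂ => ⟨(h2 Θ₁ Θ₂ hΘ₁ hΘ₂).1, ?_⟩⟩
  · rw [(h1 Θ hΘ φ ψ).2]
    exact hinv _
  · rw [(h2 Θ₁ Θ₂ hΘ₁ hΘ₂).2]
    exact hinv _
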